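/- **Setting.** Let $d\in\{2,3\}$, $\ell\ge 1$, and let $\mathcal T_h$ be a finite conforming simplicial mesh in $\mathbb R^d$; $\Omega$ denotes the bounded open polytopic set that it partitions (the interior of the union of its closed elements). Let $\kappa_p,\lambda_p,\lambda_q,\mu_{pq}>0$ with $\Upsilon_{pq}:=\kappa_p\mu_{pq}-\lambda_p\lambda_q>0$, and put $\mathcal E_p:=\kappa_p/\lambda_p$, $\mathcal E_q:=\Upsilon_{pq}/(\lambda_q\mu_{pq})$. Let $$u_p(w)=\mathcal E_p\frac{e^w}{1+e^w},\qquad u_q(w)=\mathcal E_q e^w,$$ $$s_p(p)=p\log p+(\mathcal E_p-p)\log(\mathcal E_p-p)+\max\{\mathcal E_p\log(2\mathcal E_p^{-1}),0\},\qquad s_q(q)=q(\log(\mathcal E_q^{-1}q)-1)+\mathcal E_q,$$ $$f_p(p,q)=-p(\lambda_p+\mu_{pq}q)+\kappa_p,\qquad f_q(p,q)=-q(\lambda_q-\mu_{pq}p).$$ Let $\boldsymbol D\in L^\infty(\Omega)^{d\times d}$ be symmetric and uniformly positive definite a.e.: $z^\top\boldsymbol D z\ge d_{\rm upd}|z|^2$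 for all $z\in\mathbb R^d$, with $d_{\rm upd}>0$. On the facets of each element $K$ the values of $\boldsymbol D_{|K}$ are assumed to be bounded measurable functions (with respect to the surface measure) that are symmetric and satisfy the same lower bound a.e. Let $p_0,q_0$ be measurable on $\Omega$ with $0\le p_0\le\mathcal E_p$ a.e., $q_0\in L^\infty(\Omega)$, $q_0\ge0$ a.e. Let $0=t_0<t_1<\dots<t_{N_t}$, $\tau_n=t_n-t_{n-1}$, and let $\varepsilon>0$, $\eta_0>0$. Let $\mathcal W=\prod_{K}\mathbb P_\ell(K)$ and $\boldsymbol{\mathcal R}=\prod_K\mathbb P_\ell(K)^d$, with arbitrary fixed bases $(\psi_i)$ of $\mathcal W$ and $(\boldsymbol\phi_i)$ of $\boldsymbol{\mathcal R}$; let $\Pi_{\mathcal W}$ be the $L^2(\Omega)$-orthogonal projection onto $\mathcal W$, and let $(\cdot,\cdot)_{\rm LDG}$ be any inner product on $\mathcal W$. For each internal facet $F$ (in the set $\mathcal F_h^{\mathcal I}$) fix a numbering $K_1,K_2$ of the two elements sharing it and a weight $\gamma_F\in[0,1]$; let $\boldsymbol n_{K_i}$ be the unit normals pointing outward from $K_i$,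 $\mathsf h=\min\{{\rm diam}K_1,{\rm diam}K_2\}$, $$[[w]]_{\sf N}=w_{|K_1}\boldsymbol n_{K_1}+w_{|K_2}\boldsymbol n_{K_2},\qquad \{\{\boldsymbol\phi\}\}_{1-\gamma_F}=\gamma_F\boldsymbol\phi_{|K_1}+(1-\gamma_F)\boldsymbol\phi_{|K_2},\qquad \eta_F=\eta_0\ell^2\,\frac{2a_1a_2}{a_1+a_2},\quad a_i=\boldsymbol n_{K_i}^\top\boldsymbol D_{|K_i}\boldsymbol n_{K_i}.$$ Let $M_I,M_D,B,J,A_{\rm LDG}$ be the matrices, in these bases, of the bilinear forms $(\boldsymbol z,\boldsymbol\phi)_\Omega$, $(\boldsymbol D\boldsymbol z,\boldsymbol\phi)_\Omega$, $(\nabla_h w,\boldsymbol\phi)_\Omega-\sum_{F\in\mathcal F_h^{\mathcal I}}([[w]]_{\sf N},\{\{\boldsymbol\phi\}\}_{1-\gamma_F})_F$ (with $\nabla_h$ the elementwise gradient), $\sum_{F\in\mathcal F_h^{\mathcal I}}(\eta_F\mathsf h^{-1}[[w]]_{\sf N},[[\psi]]_{\sf N})_F$ and $(w,\psi)_{\rm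 LDG}$, where rows are indexed by the second argument. For $\star\in\{p,q\}$, and for coefficient vectors $\mathbf W,\mathbf W_p,\mathbf W_q$ of $w,w_p,w_q\in\mathcal W$, let $$\mathcal N_\star(\mathbf W)_{ij}=(\boldsymbol D s_\star''(u_\star(w))\boldsymbol\phi_j,\boldsymbol\phi_i)_\Omega,\quad \mathcal U_\star(\mathbf W)_i=(u_\star(w),\psi_i)_\Omega,\quad \mathcal F_\star(\mathbf W_p,\mathbf W_q)_i=(f_\star(u_p(w_p),u_q(w_q)),\psi_i)_\Omega,$$ and let $\mathcal U^{(n)}_{\star,h}$ be the vector with entries $(u_{\star,h}^{(n)},\psi_i)_\Omega$, where $u_{p,h}^{(0)}=\Pi_{\mathcal W}p_0$, $u_{q,h}^{(0)}=\Pi_{\mathcal W}q_0$, and $u_{\star,h}^{(n)}=\Pi_{\mathcal W}u_\star(w_{\star,h}^{(n)})$ for $n\ge1$, with $w_{\star,h}^{(n)}$ the function whose coefficient vector is $\mathbf W_{\star,h}^{(n)}$. **Theorem (Existence of discrete solutions).** For each time step $n=0,\dots,N_t-1$, and for any solutions of the previous steps, the nonlinear algebraic backward Euler–LDG system $$\mathcal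 N_\star(\mathbf W_{\star,h}^{(n+1)})\mathbf\Sigma_{\star,h}^{(n+1)}=-M_DM_I^{-1}B\,\mathbf W_{\star,h}^{(n+1)},$$ $$\varepsilon A_{\rm LDG}\mathbf W_{\star,h}^{(n+1)}+\tfrac1{\tau_{n+1}}\mathcal U_\star(\mathbf W_{\star,h}^{(n+1)})-B^\top M_I^{-1}M_D\mathbf\Sigma_{\star,h}^{(n+1)}+J\mathbf W_{\star,h}^{(n+1)}=\mathcal F_\star(\mathbf W_{p,h}^{(n+1)},\mathbf W_{q,h}^{(n+1)})+\tfrac1{\tau_{n+1}}\mathcal U_{\star,h}^{(n)},\qquad \star=p,q,$$ admits a solution $(\mathbf W_{p,h}^{(n+1)},\mathbf W_{q,h}^{(n+1)},\mathbf\Sigma_{p,h}^{(n+1)},\mathbf\Sigma_{q,h}^{(n+1)})$. In particular, there is a sequence of solutions over all the time steps $n=0,\dots,N_t-1$. -/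

import Mathlib

open MeasureTheory Matrix

noncomputable section

namespace ConformationalLDG

/-- `ℝ^d` with its Euclidean structure. -/
abbrev E (d : ℕ) : Type := EuclideanSpace ℝ (Fin d)

/-! ### The continuous model: rates, change of variables, entropy densities, reaction terms -/

/-- The two unknowns `p` and `q`. -/
inductive Species where
  | p : Species
  | q : Species

/-- The reaction rates `κ_p, λ_p, λ_q, μ_pq`. -/
structure Rates where
  kappa : ℝ
  lamP : ℝ
  lamQ : ℝ
  mu : ℝ

namespace Rates

variable (r : Rates)

/-- `Υ_pq = κ_p μ_pq - λ_p λ_q`. -/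
def upsilon : ℝ := r.kappa * r.mu - r.lamP * r.lamQ

/-- `E_p = κ_p / λ_p`. -/
def equiP : ℝ := r.kappa / r.lamP

/-- `E_q = Υ_pq / (λ_q μ_pq)`. -/
def equiQ : ℝ := r.upsilon / (r.lamQ * r.mu)

/-- The change of variables `u_p(w) = E_p e^w / (1 + e^w)`, `u_q(w) = E_q e^w`. -/
def u : Species → ℝ → ℝ
  | .p, w => r.equiP * (Real.exp w / (1 + Real.exp w))
  | .q, w => r.equiQ * Real.exp w

/-- The entropy densities `s_p` (on `(0, E_p)`) and `s_q` (on `(0, ∞)`). -/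
def entropy : Species → ℝ → ℝ
  | .p, x => x * Real.log x + (r.equiP - x) * Real.log (r.equiP - x)
      + max (r.equiP * Real.log (2 * r.equiP⁻¹)) 0
  | .q, x => x * (Real.log (r.equiQ⁻¹ * x) - 1) + r.equiQ

/-- The second derivatives `s_p''` and `s_q''` of the entropy densities. -/
def entropyDD (c : Species) : ℝ → ℝ := deriv (deriv (r.entropy c))

/-- The reaction terms `f_p(p, q)` and `f_q(p, q)`. -/
def f : Species → ℝ → ℝ → ℝ
  | .p, p, q => -p * (r.lamP + r.mu * q) + r.kappa
  | .q, p, q => -q * (r.lamQ - r.mu * p)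

theorem entropyDD_p {x : ℝ} (h0 : 0 < x) (h1 : x < r.equiP) :
    r.entropyDD .p x = 1 / (x * (1 - r.equiP⁻¹ * x)) := by
  have hd : ∀ y ∈ Set.Ioo 0 r.equiP,
      HasDerivAt (r.entropy .p) (Real.log y - Real.log (r.equiP - y)) y := by
    intro y hy
    have hy0 : y ≠ 0 := hy.1.ne'
    have hy1 : r.equiP - y ≠ 0 := (sub_pos.2 hy.2).ne'
    have ha : HasDerivAt (fun y => r.equiP - y) (-1) y := by
      simpa using (hasDerivAt_id y).const_sub r.equiP
    have h := (((hasDerivAt_id y).mul (Real.hasDerivAt_log hy0)).add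
      (ha.mul (ha.log hy1))).add_const (max (r.equiP * Real.log (2 * r.equiP⁻¹)) 0)
    refine h.congr_deriv ?_
    simp only [id]
    field_simp
    ring
  have hev : deriv (r.entropy .p) =ᶠ[nhds x]
      fun y => Real.log y - Real.log (r.equiP - y) := by
    filter_upwards [Ioo_mem_nhds h0 h1] with y hy using (hd y hy).deriv
  have hx1 : r.equiP - x ≠ 0 := (sub_pos.2 h1).ne'
  have hE : r.equiP ≠ 0 := (h0.trans h1).ne'
  have ha : HasDerivAt (fun y => r.equiP - y) (-1) x := by
    simpa using (hasDerivAt_id x).const_sub r.equiP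
  have h2 := (Real.hasDerivAt_log h0.ne').sub (ha.log hx1)
  have h3 : 1 - r.equiP⁻¹ * x = r.equiP⁻¹ * (r.equiP - x) := by
    field_simp
  rw [entropyDD, hev.deriv_eq]
  refine h2.deriv.trans ?_
  rw [h3]
  have h0' := h0.ne'
  field_simp
  ring

theorem entropyDD_q (hq : 0 < r.equiQ) {x : ℝ} (h0 : 0 < x) :
    r.entropyDD .q x = 1 / x := by
  have hd : ∀ y ∈ Set.Ioi (0 : ℝ),
      HasDerivAt (r.entropy .q) (Real.log (r.equiQ⁻¹ * y)) y := by
    intro y hy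
    have hy0 : y ≠ 0 := (Set.mem_Ioi.1 hy).ne'
    have hm : r.equiQ⁻¹ * y ≠ 0 := mul_ne_zero (inv_ne_zero hq.ne') hy0
    have ha : HasDerivAt (fun y => r.equiQ⁻¹ * y) r.equiQ⁻¹ y := by
      simpa using (hasDerivAt_id y).const_mul r.equiQ⁻¹
    have h := ((hasDerivAt_id y).mul ((ha.log hm).sub_const 1)).add_const r.equiQ
    refine h.congr_deriv ?_
    simp only [id]
    field_simp
    ring
  have hev : deriv (r.entropy .q) =ᶠ[nhds x] fun y => Real.log (r.equiQ⁻¹ * y) := by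
    filter_upwards [Ioi_mem_nhds h0] with y hy using (hd y hy).deriv
  have hm : r.equiQ⁻¹ * x ≠ 0 := mul_ne_zero (inv_ne_zero hq.ne') h0.ne'
  have ha : HasDerivAt (fun y => r.equiQ⁻¹ * y) r.equiQ⁻¹ x := by
    simpa using (hasDerivAt_id x).const_mul r.equiQ⁻¹
  rw [entropyDD, hev.deriv_eq, (ha.log hm).deriv]
  have h0' := h0.ne'
  field_simp

end Rates

/-- `A ∈ L^∞(μ)^{d×d}` is symmetric and uniformly positive definite with constant `c`, `μ`-a.e. -/
structure IsDiffusionTensor {d : ℕ} (μ : Measure (E d))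
    (A : E d → Matrix (Fin d) (Fin d) ℝ) (c : ℝ) : Prop where
  memLp : ∀ i j, MemLp (fun x => A x i j) ⊤ μ
  symm : ∀ᵐ x ∂μ, (A x).IsSymm
  coercive : ∀ᵐ x ∂μ, ∀ z : Fin d → ℝ, c * (z ⬝ᵥ z) ≤ z ⬝ᵥ (A x *ᵥ z)

/-! ### Meshes, facets, normals -/

/-- A finite conforming simplicial mesh in `ℝ^d`: a finite simplicial complex in which every
simplex is a face of a `d`-dimensional one. -/
structure Mesh (d : ℕ) where
  complex : Geometry.SimplicialComplex ℝ (E d)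
  finite : complex.faces.Finite
  pure : ∀ s ∈ complex.faces, ∃ t ∈ complex.faces, s ⊆ t ∧ t.card = d + 1

namespace Mesh

variable {d : ℕ} (T : Mesh d)

/-- The open polytopic set `Ω` that is partitioned by the mesh. -/
def domain : Set (E d) := interior T.complex.space

/-- The elements: the `d`-dimensional simplices (given by their `d + 1` vertices). -/
def Elem : Type := {K : Finset (E d) // K ∈ T.complex.faces ∧ K.card = d + 1}

/-- The internal facets: `(d-1)`-dimensional simplices shared by two different elements. -/
def InnerFacet : Type :=
  {F : Finset (E d) // F ∈ T.complex.faces ∧ F.card = d ∧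
    ∃ K L : T.Elem, K ≠ L ∧ F ⊆ K.1 ∧ F ⊆ L.1}

instance : Finite T.Elem :=
  (T.finite.subset (fun _ h => h.1 : {K | K ∈ T.complex.faces ∧ K.card = d + 1} ⊆ _)).to_subtype

instance : Finite T.InnerFacet :=
  (T.finite.subset (fun _ h => h.1 : {F | F ∈ T.complex.faces ∧ F.card = d ∧
    ∃ K L : T.Elem, K ≠ L ∧ F ⊆ K.1 ∧ F ⊆ L.1} ⊆ _)).to_subtype

instance : Fintype T.Elem := Fintype.ofFinite _

instance : Fintype T.InnerFacet := Fintype.ofFinite _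

/-- A numbering `K₁, K₂` of the two elements that share each internal facet. -/
structure FacetNumbering where
  fst : T.InnerFacet → T.Elem
  snd : T.InnerFacet → T.Elem
  ne : ∀ F, fst F ≠ snd F
  fst_sub : ∀ F, F.1 ⊆ (fst F).1
  snd_sub : ∀ F, F.1 ⊆ (snd F).1

variable {T}

/-- The closed simplex spanned by the vertices of an element. -/
def Elem.carrier (K : T.Elem) : Set (E d) := convexHull ℝ (K.1 : Set (E d))

/-- The diameter `h_K`. -/
def Elem.diam (K : T.Elem) : ℝ := Metric.diam K.carrier

/-- The surface measure on a facet `F`. -/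
def InnerFacet.surface (F : T.InnerFacet) : Measure (E d) :=
  (μHE[d - 1]).restrict (convexHull ℝ (F.1 : Set (E d)))

/-- The component orthogonal to `F` of the vector from the barycentre of `F` to that of `K`; it is
normal to `F` and points into `K`. -/
def inward (K : T.Elem) (F : T.InnerFacet) : E d :=
  ((vectorSpan ℝ (F.1 : Set (E d)))ᗮ).starProjection (K.1.centroid ℝ id - F.1.centroid ℝ id)

/-- The unit normal `n_K` on the facet `F` of `K`, pointing outward from `K`. -/
def normal (K : T.Elem) (F : T.InnerFacet) : E d := -(‖inward K F‖⁻¹ • inward K F)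

variable (T)

/-- `W^ℓ(T_h) = ∏_K P_ℓ(K)`, the scalar broken polynomials of degree at most `ℓ`. -/
abbrev W (l : ℕ) : Type := T.Elem → MvPolynomial.restrictTotalDegree (Fin d) ℝ l

/-- `R^ℓ(T_h) = ∏_K P_ℓ(K)^d`, the `d`-vector-valued broken polynomials. -/
abbrev R (l : ℕ) : Type := T.Elem → Fin d → MvPolynomial.restrictTotalDegree (Fin d) ℝ l

variable {T} {l : ℕ}

/-- The value of `w|_K` at `x`. -/
def evalW (w : T.W l) (K : T.Elem) (x : E d) : ℝ :=
  MvPolynomial.eval (fun i => x i) (w K).1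

/-- The value of `φ|_K` at `x`. -/
def evalR (φ : T.R l) (K : T.Elem) (x : E d) : Fin d → ℝ :=
  fun i => MvPolynomial.eval (fun j => x j) (φ K i).1

/-- The elementwise gradient `∇_h w` at `x ∈ K`. -/
def gradW (w : T.W l) (K : T.Elem) (x : E d) : Fin d → ℝ :=
  fun i => MvPolynomial.eval (fun j => x j) (MvPolynomial.pderiv i (w K).1)

/-- The integral over `Ω` of a function that is given element by element. -/
def integral (g : T.Elem → E d → ℝ) : ℝ := ∑ K, ∫ x in K.carrier, g K x

end Mesh

/-! ### The data of the scheme -/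

/-- The data of the fully discrete method; `ιW` and `ιR` index the chosen bases. -/
structure Scheme (d l : ℕ) (ιW ιR : Type*) where
  /-- the reaction rates -/
  rates : Rates
  /-- the space mesh -/
  T : Mesh d
  /-- the numbering of the two elements at each internal facet -/
  num : T.FacetNumbering
  /-- the diffusion tensor -/
  D : E d → Matrix (Fin d) (Fin d) ℝ
  /-- `trD K` holds the values of `D|_K` on the facets of `K` -/
  trD : T.Elem → E d → Matrix (Fin d) (Fin d) ℝ
  /-- the initial data `p_0` and `q_0` -/
  initial : Species → E d → ℝ
  /-- the number `N_t` of time steps -/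
  steps : ℕ
  /-- the nodes `t_0 < t_1 < … < t_{N_t}` of the time partition -/
  t : ℕ → ℝ
  /-- the penalty parameter `ε` -/
  eps : ℝ
  /-- the constant `η_0` in the stability parameters -/
  eta0 : ℝ
  /-- the weights `γ_F` -/
  gamma : T.InnerFacet → ℝ
  /-- the inner product `(·,·)_LDG` on `W^ℓ(T_h)` -/
  ldg : LinearMap.BilinForm ℝ (T.W l)
  /-- the basis of `W^ℓ(T_h)` -/
  basisW : Module.Basis ιW ℝ (T.W l)
  /-- the basis of `R^ℓ(T_h)` -/
  basisR : Module.Basis ιR ℝ (T.R l)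

namespace Scheme

variable {d l : ℕ} {ιW ιR : Type*} [Fintype ιW] [DecidableEq ιW] [Fintype ιR] [DecidableEq ιR]
variable (S : Scheme d l ιW ιR)

/-! ### Facet quantities -/

/-- The mesh size function on `F`: `min {h_{K₁}, h_{K₂}}`. -/
def meshSize (F : S.T.InnerFacet) : ℝ := min (S.num.fst F).diam (S.num.snd F).diam

/-- `n_K^T D|_K n_K` on `F`. -/
def normalD (F : S.T.InnerFacet) (K : S.T.Elem) (x : E d) : ℝ :=
  (fun i => Mesh.normal K F i) ⬝ᵥ (S.trD K x *ᵥ fun i => Mesh.normal K F i)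

/-- The stability parameter `η_F`, at a point of `F`. -/
def eta (F : S.T.InnerFacet) (x : E d) : ℝ :=
  S.eta0 * (l : ℝ) ^ 2 *
    (2 * S.normalD F (S.num.fst F) x * S.normalD F (S.num.snd F) x
      / (S.normalD F (S.num.fst F) x + S.normalD F (S.num.snd F) x))

/-- The normal jump `[[w]]_N = w|_{K₁} n_{K₁} + w|_{K₂} n_{K₂}` on `F`. -/
def jump (w : S.T.W l) (F : S.T.InnerFacet) (x : E d) : Fin d → ℝ := fun i =>
  Mesh.evalW w (S.num.fst F) x * Mesh.normal (S.num.fst F) F i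
    + Mesh.evalW w (S.num.snd F) x * Mesh.normal (S.num.snd F) F i

/-- The weighted mean `{{φ}}_{1-γ_F} = γ_F φ|_{K₁} + (1 - γ_F) φ|_{K₂}` on `F`. -/
def mean (φ : S.T.R l) (F : S.T.InnerFacet) (x : E d) : Fin d → ℝ :=
  S.gamma F • Mesh.evalR φ (S.num.fst F) x + (1 - S.gamma F) • Mesh.evalR φ (S.num.snd F) x

/-! ### The forms and functionals -/

/-- `m_h(z, φ) = (z, φ)_Ω`. -/
def mForm (z φ : S.T.R l) : ℝ :=
  Mesh.integral fun K x => Mesh.evalR z K x ⬝ᵥ Mesh.evalR φ K x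

/-- `b_h(w, φ) = (∇_h w, φ)_Ω - ∑_F ([[w]]_N, {{φ}}_{1-γ_F})_F`. -/
def bForm (w : S.T.W l) (φ : S.T.R l) : ℝ :=
  Mesh.integral (fun K x => Mesh.gradW w K x ⬝ᵥ Mesh.evalR φ K x)
    - ∑ F : S.T.InnerFacet, ∫ x, S.jump w F x ⬝ᵥ S.mean φ F x ∂F.surface

/-- `j_h(w, ψ) = ∑_F (η_F h⁻¹ [[w]]_N, [[ψ]]_N)_F`. -/
def jForm (w ψ : S.T.W l) : ℝ :=
  ∑ F : S.T.InnerFacet,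
    ∫ x, S.eta F x * (S.meshSize F)⁻¹ * (S.jump w F x ⬝ᵥ S.jump ψ F x) ∂F.surface

/-- `d_h(z, φ) = ∑_K (D z, φ)_K`. -/
def dForm (z φ : S.T.R l) : ℝ :=
  Mesh.integral fun K x => (S.D x *ᵥ Mesh.evalR z K x) ⬝ᵥ Mesh.evalR φ K x

/-- `n_{⋆,h}(w; σ, φ) = ∑_K (D s_⋆''(u_⋆(w)) σ, φ)_K`. -/
def nForm (c : Species) (w : S.T.W l) (σ φ : S.T.R l) : ℝ :=
  Mesh.integral fun K x =>
    S.rates.entropyDD c (S.rates.u c (Mesh.evalW w K x))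
      * ((S.D x *ᵥ Mesh.evalR σ K x) ⬝ᵥ Mesh.evalR φ K x)

/-- `u_{⋆,h}(w, ψ) = (u_⋆(w), ψ)_Ω`. -/
def uForm (c : Species) (w ψ : S.T.W l) : ℝ :=
  Mesh.integral fun K x => S.rates.u c (Mesh.evalW w K x) * Mesh.evalW ψ K x

/-- `f_{⋆,h}(w_p, w_q; ψ) = (f_⋆(u_p(w_p), u_q(w_q)), ψ)_Ω`. -/
def fForm (c : Species) (wp wq ψ : S.T.W l) : ℝ :=
  Mesh.integral fun K x =>
    S.rates.f c (S.rates.u .p (Mesh.evalW wp K x)) (S.rates.u .q (Mesh.evalW wq K x))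
      * Mesh.evalW ψ K x

/-! ### Matrices and nonlinear operators in the chosen bases -/

/-- The function with coefficient vector `w`. -/
def fn (w : ιW → ℝ) : S.T.W l := ∑ i, w i • S.basisW i

/-- The mass matrix `M_I`. -/
def matM : Matrix ιR ιR ℝ := .of fun i j => S.mForm (S.basisR j) (S.basisR i)

/-- The matrix `B` of `b_h`. -/
def matB : Matrix ιR ιW ℝ := .of fun i j => S.bForm (S.basisW j) (S.basisR i)

/-- The matrix `J` of `j_h`. -/
def matJ : Matrix ιW ιW ℝ := .of fun i j => S.jForm (S.basisW j) (S.basisW i)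

/-- The matrix `M_D` of `d_h`. -/
def matD : Matrix ιR ιR ℝ := .of fun i j => S.dForm (S.basisR j) (S.basisR i)

/-- The matrix `A_LDG` of `(·,·)_LDG`. -/
def matA : Matrix ιW ιW ℝ := .of fun i j => S.ldg (S.basisW j) (S.basisW i)

/-- The matrix `N_⋆(W)`. -/
def matN (c : Species) (w : ιW → ℝ) : Matrix ιR ιR ℝ :=
  .of fun i j => S.nForm c (S.fn w) (S.basisR j) (S.basisR i)

/-- The vector `U_⋆(W)`. -/
def vecU (c : Species) (w : ιW → ℝ) : ιW → ℝ := fun i => S.uForm c (S.fn w) (S.basisW i)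

/-- The vector `F_⋆(W_p, W_q)`. -/
def vecF (c : Species) (wp wq : ιW → ℝ) : ιW → ℝ :=
  fun i => S.fForm c (S.fn wp) (S.fn wq) (S.basisW i)

/-- The Gram matrix of the basis of `W^ℓ(T_h)` in `L²(Ω)`. -/
def gramW : Matrix ιW ιW ℝ :=
  .of fun i j => Mesh.integral fun K x =>
    Mesh.evalW (S.basisW j) K x * Mesh.evalW (S.basisW i) K x

/-- The `L²(Ω)`-orthogonal projection `Π_W g` of a function given element by element; its coefficient
vector solves the normal equations. -/
def projW (g : S.T.Elem → E d → ℝ) : S.T.W l :=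
  S.fn (S.gramW⁻¹ *ᵥ fun i => Mesh.integral fun K x => g K x * Mesh.evalW (S.basisW i) K x)

/-- The quantity `u_{⋆,h}^{(n)}` transmitted from the previous step: `Π_W` of the initial datum if
`n = 0`, and `Π_W u_⋆(w^{(n)})` otherwise. -/
def transmitted (n : ℕ) (prev : Species → ιW → ℝ) (c : Species) : S.T.W l :=
  if n = 0 then S.projW fun _ x => S.initial c x
  else S.projW fun K x => S.rates.u c (Mesh.evalW (S.fn (prev c)) K x)

/-- The vector `U_{⋆,h}^{(n)}`, with entries `(u_{⋆,h}^{(n)}, ψ_i)_Ω`. -/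
def vecPrev (n : ℕ) (prev : Species → ιW → ℝ) (c : Species) : ιW → ℝ := fun i =>
  Mesh.integral fun K x =>
    Mesh.evalW (S.transmitted n prev c) K x * Mesh.evalW (S.basisW i) K x

/-- The time step `τ_{n+1} = t_{n+1} - t_n`. -/
def tau (n : ℕ) : ℝ := S.t (n + 1) - S.t n

/-- The algebraic system for the step from `t_n` to `t_{n+1}`: `prev` are the coefficient vectors
`W_⋆^{(n)}` (not used when `n = 0`), and `(w, s)` are the unknowns
`(W_⋆^{(n+1)}, Σ_⋆^{(n+1)})`, `⋆ = p, q`. -/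
def IsStep (n : ℕ) (prev w : Species → ιW → ℝ) (s : Species → ιR → ℝ) : Prop :=
  ∀ c : Species,
    S.matN c (w c) *ᵥ s c = -(S.matD *ᵥ (S.matM⁻¹ *ᵥ (S.matB *ᵥ w c))) ∧
    S.eps • (S.matA *ᵥ w c) + (1 / S.tau n) • S.vecU c (w c)
        - S.matBᵀ *ᵥ (S.matM⁻¹ *ᵥ (S.matD *ᵥ s c)) + S.matJ *ᵥ w c
      = S.vecF c (w .p) (w .q) + (1 / S.tau n) • S.vecPrev n prev c

end Scheme

end ConformationalLDG

end

/-!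
The unknowns `Σ_⋆` can be eliminated, because `N_⋆(W)` is positive definite for every `W`: the first
equation gives `Σ_⋆ = -N_⋆(W_⋆)⁻¹ M_D M_I⁻¹ B W_⋆`, and what remains is a continuous nonlinear
equation for the pair `(W_p, W_q)` in a finite-dimensional space (`Scheme.reducedOp`). The data of
the previous step only enter through a fixed vector on its right-hand side.

It is solved with Brouwer's theorem, in the form that a continuous vector field pointing outward on
a sphere has a zero (`exists_eq_zero_of_continuous_of_inner_pos`). Brouwer's theorem is proved by
the argument of Milnor and Rogers: for a `C¹` retraction `r` of the ball onto the sphere, the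
integral over the ball of the Jacobian of `x + t (r x - x)` is a polynomial in `t` that equals the
volume of the ball for small `t`, but vanishes for `t = 1`.

Tested with the solution, the left-hand side is coercive: the diffusive and jump terms are
nonnegative, `u_⋆(w) w` is bounded below and the penalty term is quadratic
(`Scheme.exists_mul_sq_norm_sub_le_reducedOp`). The reaction terms are not bounded by this for large
time steps, since `f_q(p, q) w_q` contributes `∫ q w_q⁺`, exponential in `w_q`. The bound comes from
a second test, with the constant `1`: it annihilates the jump terms and the diffusion, because the
normals of the two elements at a facet are opposite (`Mesh.normal_snd_eq_neg_normal_fst`), and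
`f_p + f_q ≤ κ_p`, whence `∫ q ≤ C (1 + ‖W‖)` (`Scheme.exists_integral_u_q_le`). As `q` is
exponential in `w_q`, the maximum of the polynomial `w_q` is then at most `δ ‖W‖ + C_δ` for every
`δ > 0` (`Scheme.exists_max_evalW_le_of_integral_u_q_le`), so that `∫ q w_q⁺` is absorbed by the
penalty term. This a priori bound is uniform when the right-hand side is multiplied by `θ ∈ [0, 1]`
(`Scheme.exists_norm_add_norm_le`). Hence, if the right-hand side is cut off beyond the bound, the
vector field points outward on a large sphere, and its zero satisfies the bound, so that it solves
the original equation (`Scheme.exists_reducedOp_eq`).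
-/

/-! ### Brouwer's theorem -/

theorem LinearMap.det_eq_zero_of_range_ne_top {V : Type*} [AddCommGroup V] [Module ℝ V]
    [FiniteDimensional ℝ V] {f : V →ₗ[ℝ] V} (hf : f.range ≠ ⊤) : LinearMap.det f = 0 :=
  LinearMap.det_eq_zero_iff_ker_ne_bot.2 fun h => hf (LinearMap.ker_eq_bot_iff_range_eq_top.1 h)

theorem LinearMap.exists_polynomial_eval_eq_det_one_add_smul {V : Type*} [AddCommGroup V]
    [Module ℝ V] [FiniteDimensional ℝ V] (M : V →ₗ[ℝ] V) :
    ∃ P : Polynomial ℝ, P.natDegree ≤ Module.finrank ℝ V ∧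
      ∀ t : ℝ, P.eval t = LinearMap.det (1 + t • M) := by
  classical
  let b := Module.finBasis ℝ V
  let A := LinearMap.toMatrix b b M
  refine ⟨((Polynomial.X : Polynomial ℝ) • A.map (Polynomial.C (R := ℝ))
    + (1 : Matrix (Fin (Module.finrank ℝ V)) (Fin (Module.finrank ℝ V)) ℝ).map
      (Polynomial.C (R := ℝ))).det, ?_, fun t => ?_⟩
  · simpa using Polynomial.natDegree_det_X_add_C_le A 1
  · rw [← LinearMap.det_toMatrix b, ← Polynomial.coe_evalRingHom, RingHom.map_det]
    congr 1
    ext i j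
    simp [A, Matrix.one_apply, LinearMap.toMatrix_one]
    split_ifs <;> simp <;> ring

section Brouwer

variable {V : Type*} [NormedAddCommGroup V] [InnerProductSpace ℝ V] [FiniteDimensional ℝ V]
  {r : V → V}

open Metric Set

/-- A linear perturbation of the identity of norm less than one is invertible, with positive
determinant. -/
theorem ContinuousLinearMap.det_one_add_smul_pos {M : V →L[ℝ] V} {C t : ℝ} (hM : ‖M‖ ≤ C)
    (ht : 0 ≤ t) (htC : t * C < 1) : 0 < (1 + t • M).det := by
  have hne : ∀ s ∈ Icc 0 t, (1 + s • M).det ≠ 0 := by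
    intro s hs h0
    obtain ⟨x, hx, hx0⟩ := (Submodule.ne_bot_iff _).1 (LinearMap.bot_lt_ker_of_det_eq_zero h0).ne'
    have hx1 : x = -(s • M x) := by
      have h : x + s • M x = 0 := by simpa using hx
      exact eq_neg_of_add_eq_zero_left h
    have h1 : ‖x‖ ≤ s * (C * ‖x‖) := by
      conv_lhs => rw [hx1, norm_neg, norm_smul, Real.norm_of_nonneg hs.1]
      have := M.le_of_opNorm_le hM x
      exact mul_le_mul_of_nonneg_left this hs.1
    have hxp : 0 < ‖x‖ := norm_pos_iff.2 hx0
    have hC : 0 ≤ C := (norm_nonneg M).trans hM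
    have h2 : s * C ≤ t * C := mul_le_mul_of_nonneg_right hs.2 hC
    nlinarith
  have hc : Continuous fun s : ℝ => (1 + s • M).det :=
    ContinuousLinearMap.continuous_det.comp (by fun_prop)
  by_contra! hneg
  have h1 : (1 + (0 : ℝ) • M).det = 1 := by
    simp only [zero_smul, add_zero]
    exact LinearMap.det_id
  obtain ⟨s, hs, hs0⟩ := intermediate_value_Icc' ht hc.continuousOn
    (show (0 : ℝ) ∈ Icc ((1 + t • M).det) ((1 + (0 : ℝ) • M).det) from
      ⟨hneg, by rw [h1]; exact zero_le_one⟩)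
  exact hne s hs hs0

/-- For small `t`, the homotopy `x ↦ x + t (r x - x)` from the identity to a map `r` of the ball
that fixes the sphere maps the ball onto itself, so that its Jacobian has integral `vol B`. -/
theorem integral_det_homotopy_eq_volume [MeasurableSpace V] [BorelSpace V]
    (hr : ∀ x ∈ closedBall (0 : V) 1, ContDiffAt ℝ 1 r x)
    (hmap : ∀ x ∈ closedBall (0 : V) 1, r x ∈ closedBall (0 : V) 1)
    (hfix : ∀ x ∈ sphere (0 : V) 1, r x = x)
    {C : ℝ} (hC : ∀ x ∈ closedBall (0 : V) 1, ‖fderiv ℝ r x - 1‖ ≤ C)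
    {t : ℝ} (ht : 0 ≤ t) (ht1 : t ≤ 1) (htC : t * C < 1) :
    ∫ x in ball (0 : V) 1, (1 + t • (fderiv ℝ r x - 1)).det = volume.real (ball (0 : V) 1) := by
  set h : V → V := fun x => x + t • (r x - x) with hh
  have hd : ∀ x ∈ closedBall (0 : V) 1,
      HasStrictFDerivAt h (1 + t • (fderiv ℝ r x - 1)) x := fun x hx =>
    (hasStrictFDerivAt_id x).add
      ((((hr x hx).hasStrictFDerivAt one_ne_zero).sub (hasStrictFDerivAt_id x)).const_smul t)
  have hdet : ∀ x ∈ closedBall (0 : V) 1, 0 < (1 + t • (fderiv ℝ r x - 1)).det := fun x hx =>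
    ContinuousLinearMap.det_one_add_smul_pos (hC x hx) ht htC
  have hinj : InjOn h (closedBall (0 : V) 1) := by
    intro x hx y hy hxy
    have hg : ‖(r y - y) - (r x - x)‖ ≤ C * ‖y - x‖ :=
      (convex_closedBall (0 : V) 1).norm_image_sub_le_of_norm_hasFDerivWithin_le
        (f := fun x => r x - x) (f' := fun x => fderiv ℝ r x - 1)
        (fun z hz => ((((hr z hz).hasStrictFDerivAt one_ne_zero).hasFDerivAt).sub
          (hasFDerivAt_id z)).hasFDerivWithinAt) hC hx hy
    have h1 : y - x = -(t • ((r y - y) - (r x - x))) := by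
      have : x + t • (r x - x) = y + t • (r y - y) := hxy
      rw [smul_sub t (r y - y), neg_sub, sub_eq_sub_iff_add_eq_add, add_comm (t • (r x - x)),
        this]
    by_contra hne
    have hpos : 0 < ‖y - x‖ := norm_pos_iff.2 (sub_ne_zero.2 (Ne.symm hne))
    have h2 : ‖y - x‖ ≤ t * (C * ‖y - x‖) := by
      conv_lhs => rw [h1, norm_neg, norm_smul, Real.norm_of_nonneg ht]
      exact mul_le_mul_of_nonneg_left hg ht
    nlinarith
  -- the image of the open ball is contained, open and relatively closed in it
  have hmapB : MapsTo h (closedBall (0 : V) 1) (closedBall (0 : V) 1) := by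
    intro x hx
    have : h x = (1 - t) • x + t • r x := by simp only [hh]; module
    rw [this]
    exact (convex_closedBall (0 : V) 1) hx (hmap x hx) (by linarith) ht (by ring)
  have hsub : ball (0 : V) 1 ⊆ closedBall 0 1 := ball_subset_closedBall
  have hopen : IsOpen (h '' ball (0 : V) 1) := by
    rw [isOpen_iff_mem_nhds]
    rintro _ ⟨x, hx, rfl⟩
    have hs : ((1 + t • (fderiv ℝ r x - 1) : V →L[ℝ] V) : V →ₗ[ℝ] V).range = ⊤ := by
      by_contra hne
      exact (hdet x (hsub hx)).ne' (LinearMap.det_eq_zero_of_range_ne_top hne)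
    rw [← (hd x (hsub hx)).map_nhds_eq_of_surj hs]
    exact Filter.image_mem_map (isOpen_ball.mem_nhds hx)
  have hball : h '' ball (0 : V) 1 ⊆ ball 0 1 := by
    rw [← interior_closedBall (0 : V) one_ne_zero]
    refine interior_maximal ?_ (by rwa [interior_closedBall (0 : V) one_ne_zero])
    rw [interior_closedBall (0 : V) one_ne_zero]
    exact (hmapB.mono_left hsub).image_subset
  have hcont : ContinuousOn h (closedBall (0 : V) 1) := fun x hx =>
    (hd x hx).hasFDerivAt.continuousAt.continuousWithinAt
  have himg : h '' ball (0 : V) 1 = ball 0 1 := by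
    refine hball.antisymm ?_
    refine (convex_ball (0 : V) 1).isPreconnected.subset_of_closure_inter_subset hopen ?_ ?_
    · refine ⟨h 0, hball (mem_image_of_mem h (mem_ball_self one_pos)),
        mem_image_of_mem h (mem_ball_self one_pos)⟩
    · rintro y ⟨hy, hyb⟩
      have hcl : closure (h '' ball (0 : V) 1) ⊆ h '' closedBall 0 1 :=
        closure_minimal (image_mono hsub)
          (((isCompact_closedBall (0 : V) 1).image_of_continuousOn hcont).isClosed)
      obtain ⟨x, hx, rfl⟩ := hcl hy
      rcases (mem_closedBall.1 hx).lt_or_eq with hlt | heq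
      · exact mem_image_of_mem h hlt
      · exfalso
        have hx1 : x ∈ sphere (0 : V) 1 := heq
        have : h x = x := by simp [hh, hfix x hx1]
        rw [this] at hyb
        exact (mem_ball.1 hyb).ne heq
  have hI := integral_image_eq_integral_abs_det_fderiv_smul (μ := (volume : Measure V))
    measurableSet_ball (fun x hx => (hd x (hsub hx)).hasFDerivAt.hasFDerivWithinAt)
    (hinj.mono hsub) (fun _ => (1 : ℝ))
  rw [himg] at hI
  simp only [integral_const, smul_eq_mul, mul_one, measureReal_restrict_apply_univ] at hI
  rw [hI]
  refine setIntegral_congr_fun measurableSet_ball fun x hx => ?_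
  exact (abs_of_pos (hdet x (hsub hx))).symm

/-- The closed unit ball has no `C¹` retraction `r` onto the sphere. As a polynomial in `t`, the
integral of the Jacobian of `x + t (r x - x)` is determined by its values at small `t`, where it is
the volume of the ball; at `t = 1` it vanishes, because the derivative of `r` maps into the tangent
spaces of the sphere. -/
theorem not_contDiff_retraction_sphere (hr : ∀ x ∈ closedBall (0 : V) 1, ContDiffAt ℝ 1 r x)
    (hmap : ∀ x ∈ closedBall (0 : V) 1, r x ∈ sphere (0 : V) 1)
    (hfix : ∀ x ∈ sphere (0 : V) 1, r x = x) : False := by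
  borelize V
  have hsub : ball (0 : V) 1 ⊆ closedBall 0 1 := ball_subset_closedBall
  have hfc : ContinuousOn (fun x => fderiv ℝ r x - 1) (closedBall (0 : V) 1) := fun x hx =>
    ((((hr x hx).fderiv_right (m := 0) (by simp)).continuousAt).sub
      continuousAt_const).continuousWithinAt
  obtain ⟨C, hC⟩ := (isCompact_closedBall (0 : V) 1).exists_bound_of_continuousOn hfc
  have hC0 : 0 ≤ C := (norm_nonneg _).trans (hC 0 (by simp))
  set n := Module.finrank ℝ V
  -- interpolation nodes so small that the homotopy is invertible there
  let ν : ℕ → ℝ := fun i => (i : ℝ) / ((n + 1) * (C + 1))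
  have hden : 0 < ((n : ℝ) + 1) * (C + 1) := by positivity
  have hν : InjOn ν (Finset.range (n + 1) : Finset ℕ) := fun i _ j _ hij => by
    have := (div_left_inj' hden.ne').1 hij
    exact_mod_cast this
  have hν0 : ∀ i, 0 ≤ ν i := fun i => by positivity
  have hνle : ∀ i ∈ Finset.range (n + 1), ν i * (C + 1) < 1 := by
    intro i hi
    have hi' : (i : ℝ) < n + 1 := by exact_mod_cast Finset.mem_range.1 hi
    have : ν i * (C + 1) = i / (n + 1) := by
      simp only [ν]; field_simp
    rw [this, div_lt_one (by positivity)]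
    exact hi'
  have hint : ∀ t : ℝ, IntegrableOn (fun x => (1 + t • (fderiv ℝ r x - 1)).det)
      (ball (0 : V) 1) := fun t =>
    ((ContinuousLinearMap.continuous_det.comp_continuousOn
      (continuousOn_const.add (hfc.const_smul t))).integrableOn_compact
        (isCompact_closedBall 0 1)).mono_set hsub
  have hinterp : ∀ M : V →L[ℝ] V, (1 + (1 : ℝ) • M).det
      = ∑ i ∈ Finset.range (n + 1), (1 + ν i • M).det *
        (Lagrange.basis (Finset.range (n + 1)) ν i).eval 1 := by
    intro M
    obtain ⟨P, hP, hPe⟩ := LinearMap.exists_polynomial_eval_eq_det_one_add_smul (M : V →ₗ[ℝ] V)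
    have hdeg : P.degree < (Finset.range (n + 1)).card := by
      rw [Finset.card_range]
      exact (Polynomial.degree_le_natDegree).trans_lt (by exact_mod_cast Nat.lt_succ_of_le hP)
    have h1 := congrArg (Polynomial.eval 1) (Lagrange.eq_interpolate hν hdeg)
    rw [Lagrange.interpolate_apply, Polynomial.eval_finsetSum] at h1
    simp only [Polynomial.eval_mul, Polynomial.eval_C, hPe] at h1
    exact h1
  have hsum : ∑ i ∈ Finset.range (n + 1),
      (Lagrange.basis (Finset.range (n + 1)) ν i).eval 1 = 1 := by
    rw [← Polynomial.eval_finsetSum, Lagrange.sum_basis hν (by simp), Polynomial.eval_one]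
  have hvol : ∫ x in ball (0 : V) 1, (1 + (1 : ℝ) • (fderiv ℝ r x - 1)).det
      = volume.real (ball (0 : V) 1) := by
    simp_rw [hinterp]
    rw [integral_finsetSum _ fun i _ => (hint (ν i)).mul_const _]
    simp_rw [integral_mul_const]
    rw [Finset.sum_congr rfl fun i hi => by
      rw [integral_det_homotopy_eq_volume hr (fun x hx => sphere_subset_closedBall (hmap x hx))
        hfix hC (hν0 i) (by nlinarith [hνle i hi, hν0 i]) (by nlinarith [hνle i hi, hν0 i])]]
    rw [← Finset.mul_sum, hsum, mul_one]
  have hzero : ∀ x ∈ ball (0 : V) 1, (1 + (1 : ℝ) • (fderiv ℝ r x - 1)).det = 0 := by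
    intro x hx
    have hdx := ((hr x (hsub hx)).differentiableAt one_ne_zero).hasFDerivAt
    have heq : (1 + (1 : ℝ) • (fderiv ℝ r x - 1)) = fderiv ℝ r x := by
      rw [one_smul]; abel
    rw [heq]
    refine LinearMap.det_eq_zero_of_range_ne_top fun htop => ?_
    have hconst : (fun y => inner ℝ (r y) (r y)) =ᶠ[nhds x] fun _ => (1 : ℝ) := by
      filter_upwards [isOpen_ball.mem_nhds hx] with y hy
      have := hmap y (hsub hy)
      rw [mem_sphere_zero_iff_norm] at this
      rw [real_inner_self_eq_norm_sq, this, one_pow]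
    have h1 := (hdx.inner ℝ hdx).congr_of_eventuallyEq hconst.symm
    have h2 := h1.unique (hasFDerivAt_const (1 : ℝ) x)
    obtain ⟨v, hv⟩ : ∃ v, fderiv ℝ r x v = r x := by
      have : r x ∈ ((fderiv ℝ r x : V →L[ℝ] V) : V →ₗ[ℝ] V).range := by rw [htop]; trivial
      simpa using this
    have h3 := congrArg (fun L : V →L[ℝ] ℝ => L v) h2
    have h4 := hmap x (hsub hx)
    rw [mem_sphere_zero_iff_norm] at h4
    simp [hv, h4] at h3
  rw [setIntegral_congr_fun measurableSet_ball hzero] at hvol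
  simp only [integral_zero] at hvol
  have : 0 < volume.real (ball (0 : V) 1) :=
    ENNReal.toReal_pos (measure_ball_pos _ _ one_pos).ne' measure_ball_lt_top.ne
  linarith

/-- A `C¹` vector field that points outward on the unit sphere vanishes somewhere in the ball:
otherwise, the second intersection of the sphere with the line through `x` and `-g x / ‖g x‖`
would be a retraction onto the sphere. -/
theorem exists_eq_zero_of_contDiff_of_inner_pos {g : V → V} (hg : ContDiff ℝ 1 g)
    (hpos : ∀ x ∈ sphere (0 : V) 1, 0 < inner ℝ (g x) x) : ∃ x ∈ closedBall (0 : V) 1, g x = 0 := by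
  by_contra! hne
  set u : V → V := fun x => -(‖g x‖⁻¹ • g x) with hu
  have hnu : ∀ x ∈ closedBall (0 : V) 1, ‖u x‖ = 1 := fun x hx => by
    have := norm_pos_iff.2 (hne x hx)
    rw [hu]
    simp only [norm_neg, norm_smul, norm_inv, norm_norm]
    exact inv_mul_cancel₀ this.ne'
  have hux : ∀ x ∈ closedBall (0 : V) 1, x - u x ≠ 0 := by
    intro x hx h0
    have hxu : x = u x := sub_eq_zero.1 h0
    have hs : x ∈ sphere (0 : V) 1 := by
      rw [mem_sphere_zero_iff_norm, hxu]
      exact hnu x hx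
    have h1 := hpos x hs
    have h2 : g x = -(‖g x‖ • x) := by
      have h3 : ‖g x‖ • u x = -g x := by
        simp only [hu, smul_neg]
        rw [smul_smul, mul_inv_cancel₀ (norm_pos_iff.2 (hne x hx)).ne', one_smul]
      rw [← hxu] at h3
      rw [h3, neg_neg]
    rw [h2, inner_neg_left, inner_smul_left, real_inner_self_eq_norm_sq] at h1
    have : 0 ≤ ‖g x‖ * ‖x‖ ^ 2 := by positivity
    simp at h1
    linarith
  have hcu : ∀ x ∈ closedBall (0 : V) 1, ContDiffAt ℝ 1 u x := fun x hx =>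
    (((hg.contDiffAt.norm ℝ (hne x hx)).inv (norm_pos_iff.2 (hne x hx)).ne').smul
      hg.contDiffAt).neg
  refine not_contDiff_retraction_sphere
    (r := fun x => u x + (2 * (1 - inner ℝ (u x) x) / ‖x - u x‖ ^ 2) • (x - u x)) ?_ ?_ ?_
  · intro x hx
    have hsub : ContDiffAt ℝ 1 (fun x => x - u x) x := contDiffAt_id.sub (hcu x hx)
    refine (hcu x hx).add (ContDiffAt.smul (ContDiffAt.div ?_ (hsub.norm_sq ℝ) ?_) hsub)
    · exact contDiffAt_const.mul (contDiffAt_const.sub ((hcu x hx).inner ℝ contDiffAt_id))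
    · exact pow_ne_zero 2 (norm_pos_iff.2 (hux x hx)).ne'
  · intro x hx
    rw [mem_sphere_zero_iff_norm, ← sq_eq_sq₀ (norm_nonneg _) zero_le_one, norm_add_sq_real,
      norm_smul, hnu x hx, inner_smul_right, inner_sub_right, real_inner_self_eq_norm_sq, hnu x hx,
      mul_pow, Real.norm_eq_abs, sq_abs]
    have := norm_pos_iff.2 (hux x hx)
    field_simp
    ring
  · intro x hx
    have hx' := sphere_subset_closedBall hx
    have h1 : ‖x - u x‖ ^ 2 = 2 * (1 - inner ℝ (u x) x) := by
      rw [norm_sub_sq_real, hnu x hx', mem_sphere_zero_iff_norm.1 hx, real_inner_comm]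
      ring
    have := norm_pos_iff.2 (hux x hx')
    simp only [← h1]
    rw [div_self (by positivity), one_smul, add_sub_cancel]

/-- A form of Brouwer's fixed point theorem: a continuous vector field that points outward on a
sphere vanishes somewhere. -/
theorem exists_eq_zero_of_continuous_of_inner_pos {g : V → V} (hg : Continuous g) {R : ℝ}
    (hR : 0 < R) (hpos : ∀ x ∈ sphere (0 : V) R, 0 < inner ℝ (g x) x) : ∃ x, g x = 0 := by
  by_contra! hne
  have hgs : Continuous fun x => g (R • x) := hg.comp (continuous_const_smul R)
  obtain ⟨m, hm, hmle⟩ : ∃ m : ℝ, 0 < m ∧ ∀ x ∈ closedBall (0 : V) 1, m ≤ ‖g (R • x)‖ := by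
    obtain ⟨x, -, hx⟩ := (isCompact_closedBall (0 : V) 1).exists_isMinOn ⟨0, by simp⟩
      hgs.norm.continuousOn
    exact ⟨_, norm_pos_iff.2 (hne _), fun y hy => hx hy⟩
  obtain ⟨m', hm', hmle'⟩ : ∃ m : ℝ, 0 < m ∧ ∀ x ∈ sphere (0 : V) 1, m ≤ inner ℝ (g (R • x)) x := by
    rcases (sphere (0 : V) 1).eq_empty_or_nonempty with he | hne'
    · exact ⟨1, one_pos, by simp [he]⟩
    obtain ⟨x, hx, hxm⟩ := (isCompact_sphere (0 : V) 1).exists_isMinOn hne'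
      (hgs.inner (𝕜 := ℝ) continuous_id).continuousOn
    refine ⟨inner ℝ (g (R • x)) x, ?_, fun y hy => hxm hy⟩
    have h1 := hpos (R • x) (by
      rw [mem_sphere_zero_iff_norm] at hx ⊢
      rw [norm_smul, hx, Real.norm_of_nonneg hR.le, mul_one])
    rw [inner_smul_right] at h1
    exact (mul_pos_iff_of_pos_left hR).1 h1
  obtain ⟨k, hk, hkd, -⟩ := hgs.exists_contDiff_approx 1 (ε := fun _ => min m m')
    continuous_const (fun _ => lt_min hm hm')
  obtain ⟨x, hx, hx0⟩ := exists_eq_zero_of_contDiff_of_inner_pos hk (fun x hx => by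
    have h1 := hkd x
    rw [dist_eq_norm] at h1
    have h2 : |inner ℝ (k x - g (R • x)) x| ≤ ‖k x - g (R • x)‖ * ‖x‖ := abs_real_inner_le_norm _ _
    rw [mem_sphere_zero_iff_norm.1 hx, mul_one, inner_sub_left] at h2
    have h3 := hmle' x hx
    have h4 := (abs_le.1 h2).1
    have := h1.trans_le (min_le_right m m')
    linarith)
  have h1 := hkd x
  rw [hx0, dist_zero_left] at h1
  exact absurd (h1.trans_le (min_le_left _ _)) (not_lt.2 (hmle x hx))

end Brouwer

theorem exists_eq_zero_of_continuous_of_dotProduct_pos {ι : Type*} [Fintype ι]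
    {g : (ι → ℝ) → ι → ℝ} (hg : Continuous g) {R : ℝ} (hR : 0 < R)
    (hpos : ∀ x, x ⬝ᵥ x = R ^ 2 → 0 < g x ⬝ᵥ x) : ∃ x, g x = 0 := by
  obtain ⟨x, hx⟩ := exists_eq_zero_of_continuous_of_inner_pos
    (V := EuclideanSpace ℝ ι) (g := fun x => WithLp.toLp 2 (g x.ofLp)) (by fun_prop) hR
    (fun x hx => by
      have h := hpos x.ofLp (by
        rw [← mem_sphere_zero_iff_norm.1 hx, EuclideanSpace.norm_sq_eq]
        simp [dotProduct, sq])
      rw [dotProduct_comm] at h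
      simpa [EuclideanSpace.inner_eq_star_dotProduct] using h)
  exact ⟨x.ofLp, by simpa using hx⟩

namespace ConformationalLDG

namespace Mesh

variable {d : ℕ} {T : Mesh d}

/-! ### Elements of the mesh -/

theorem Elem.isCompact_carrier (K : T.Elem) : IsCompact K.carrier :=
  K.1.finite_toSet.isCompact_convexHull ℝ

theorem Elem.convex_carrier (K : T.Elem) : Convex ℝ K.carrier := convex_convexHull ℝ _

theorem Elem.measurableSet_carrier (K : T.Elem) : MeasurableSet K.carrier :=
  K.isCompact_carrier.isClosed.measurableSet

theorem Elem.affineSpan_eq_top (K : T.Elem) : affineSpan ℝ (K.1 : Set (E d)) = ⊤ := by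
  have h := (T.complex.indep K.2.1).affineSpan_eq_top_iff_card_eq_finrank_add_one
  rw [Subtype.range_coe_subtype] at h
  refine h.2 ?_
  simp [K.2.2]

theorem Elem.interior_carrier_nonempty (K : T.Elem) : (interior K.carrier).Nonempty :=
  interior_convexHull_nonempty_iff_affineSpan_eq_top.2 K.affineSpan_eq_top

theorem Elem.carrier_subset_closure_interior (K : T.Elem) :
    K.carrier ⊆ closure (interior K.carrier) := by
  rw [K.convex_carrier.closure_interior_eq_closure_of_nonempty_interior
    K.interior_carrier_nonempty]
  exact subset_closure

theorem Elem.interior_carrier_subset_domain (K : T.Elem) : interior K.carrier ⊆ T.domain :=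
  interior_mono (T.complex.convexHull_subset_space K.2.1)

/-- As the boundary of an element is a null set and its interior lies in `Ω`, properties that hold
almost everywhere in `Ω` hold almost everywhere in each element. -/
theorem Elem.restrict_carrier_le (K : T.Elem) :
    (volume.restrict K.carrier : Measure (E d)) ≤ volume.restrict T.domain := by
  rw [← Measure.restrict_congr_set
    (interior_ae_eq_of_null_frontier (K.convex_carrier.addHaar_frontier volume))]
  exact Measure.restrict_mono K.interior_carrier_subset_domain le_rfl

/-! ### Normals and surface measures of the internal facets -/

theorem InnerFacet.nonempty (F : T.InnerFacet) : F.1.Nonempty := by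
  rw [Finset.nonempty_iff_ne_empty]
  rintro h
  exact T.complex.empty_notMem (h ▸ F.2.1)

theorem InnerFacet.dim_pos (F : T.InnerFacet) : 0 < d := by
  rw [← F.2.2.1]
  exact F.nonempty.card_pos

theorem centroid_id_eq_smul_sum {s : Finset (E d)} (hs : s.Nonempty) :
    s.centroid ℝ id = (s.card : ℝ)⁻¹ • ∑ v ∈ s, v := by
  rw [Finset.centroid_def, Finset.affineCombination_eq_linear_combination _ _ _
    (s.sum_centroidWeights_eq_one_of_nonempty ℝ hs), Finset.smul_sum]
  simp

theorem exists_opposite_vertex {K : T.Elem} {F : T.InnerFacet} (h : F.1 ⊆ K.1) :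
    ∃ a ∉ F.1, (K.1 : Set (E d)) = insert a (F.1 : Set (E d)) ∧
      ∑ v ∈ K.1, v = a + ∑ v ∈ F.1, v := by
  classical
  have hc : (K.1 \ F.1).card = 1 := by
    rw [Finset.card_sdiff_of_subset h, K.2.2, F.2.2.1]
    omega
  obtain ⟨a, ha⟩ := Finset.card_eq_one.1 hc
  have haF : a ∉ F.1 := (Finset.mem_sdiff.1 (ha ▸ Finset.mem_singleton_self a)).2
  have hK : K.1 = insert a F.1 := by
    rw [← Finset.sdiff_union_of_subset h, ha]
    rfl
  refine ⟨a, haF, ?_, ?_⟩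
  · rw [hK, Finset.coe_insert]
  · rw [hK, Finset.sum_insert haF]

theorem inward_eq_smul {K : T.Elem} {F : T.InnerFacet} {a : E d}
    (ha : ∑ v ∈ K.1, v = a + ∑ v ∈ F.1, v) :
    inward K F = ((d : ℝ) + 1)⁻¹ •
      (vectorSpan ℝ (F.1 : Set (E d)))ᗮ.starProjection (a - F.1.centroid ℝ id) := by
  have hd : (0 : ℝ) < d := by exact_mod_cast F.dim_pos
  have hK : K.1.Nonempty := Finset.card_pos.1 (by rw [K.2.2]; omega)
  rw [inward, ← map_smul, centroid_id_eq_smul_sum hK, centroid_id_eq_smul_sum F.nonempty, ha,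
    K.2.2, F.2.2.1]
  congr 1
  push_cast
  match_scalars
  · field_simp
  · field_simp
    ring

theorem centroid_mem_convexHull (F : T.InnerFacet) :
    F.1.centroid ℝ id ∈ convexHull ℝ (F.1 : Set (E d)) := by
  have hd : (0 : ℝ) < d := by exact_mod_cast F.dim_pos
  rw [Finset.mem_convexHull', centroid_id_eq_smul_sum F.nonempty, F.2.2.1]
  refine ⟨fun _ => (d : ℝ)⁻¹, fun _ _ => by positivity, ?_, ?_⟩
  · rw [Finset.sum_const, F.2.2.1, nsmul_eq_mul, mul_inv_cancel₀ hd.ne']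
  · rw [Finset.smul_sum]

/-- The vertices of two elements opposite to a common facet lie on different sides of it: otherwise
the segment from the barycentre of the facet to one of the vertices would start inside both
elements, which only meet in the facet. -/
theorem normal_snd_eq_neg_normal_fst (N : T.FacetNumbering) (F : T.InnerFacet) :
    normal (N.snd F) F = -normal (N.fst F) F := by
  classical
  obtain ⟨a, haF, hKa, hsa⟩ := exists_opposite_vertex (N.fst_sub F)
  obtain ⟨b, hbF, hKb, hsb⟩ := exists_opposite_vertex (N.snd_sub F)
  have hd : (0 : ℝ) < d := by exact_mod_cast F.dim_pos
  set c := F.1.centroid ℝ id with hc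
  have hcS : c = (d : ℝ)⁻¹ • ∑ v ∈ F.1, v := by
    rw [hc, centroid_id_eq_smul_sum F.nonempty, F.2.2.1]
  have haspan : a ∉ affineSpan ℝ (F.1 : Set (E d)) := by
    have hi := T.complex.indep (N.fst F).2.1
    have ha1 : a ∈ (N.fst F).1 := by
      have : a ∈ ((N.fst F).1 : Set (E d)) := hKa ▸ Set.mem_insert _ _
      exact this
    have := hi.notMem_affineSpan_sdiff ⟨a, ha1⟩ Set.univ
    suffices hset : ((↑) : (N.fst F).1 → E d) '' (Set.univ \ {⟨a, ha1⟩}) = (F.1 : Set (E d)) by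
      rwa [hset] at this
    ext v
    simp only [Set.mem_image, Set.mem_sdiff, Set.mem_univ, true_and, Set.mem_singleton_iff,
      Subtype.exists, Subtype.mk.injEq, exists_and_right, exists_eq_right]
    constructor
    · rintro ⟨hv, hne⟩
      have hv' : v ∈ ((N.fst F).1 : Set (E d)) := hv
      rw [hKa] at hv'
      exact hv'.resolve_left hne
    · intro hv
      have hv' : v ∈ ((N.fst F).1 : Set (E d)) := hKa ▸ Set.mem_insert_of_mem _ hv
      exact ⟨hv', fun h => haF (h ▸ hv)⟩
  -- barycentric coordinates of `a` with respect to the second element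
  obtain ⟨α, β, hαβ, hab⟩ : ∃ (α : E d → ℝ) (β : ℝ), ∑ v ∈ F.1, α v + β = 1 ∧
      a = ∑ v ∈ F.1, α v • v + β • b := by
    have ha2 : a ∈ affineSpan ℝ (Set.range ((↑) : (N.snd F).1 → E d)) := by
      have h := (N.snd F).affineSpan_eq_top
      have h2 : Set.range ((↑) : (N.snd F).1 → E d) = ((N.snd F).1 : Set (E d)) :=
        Subtype.range_coe
      rw [h2, h]
      exact AffineSubspace.mem_top ℝ _ a
    obtain ⟨w, hw, hwa⟩ := eq_affineCombination_of_mem_affineSpan_of_fintype ha2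
    rw [Finset.affineCombination_eq_linear_combination _ _ _ hw] at hwa
    let w' : E d → ℝ := fun v => if h : v ∈ (N.snd F).1 then w ⟨v, h⟩ else 0
    have hKb' : (N.snd F).1 = insert b F.1 := by
      apply Finset.coe_injective
      rw [hKb, Finset.coe_insert]
    have e1 : ∑ v ∈ (N.snd F).1, w' v = 1 := by
      rw [← hw, ← Finset.sum_coe_sort]
      exact Finset.sum_congr rfl fun v _ => by simp [w']
    have e2 : ∑ v ∈ (N.snd F).1, w' v • v = a := by
      rw [hwa, ← Finset.sum_coe_sort]
      exact Finset.sum_congr rfl fun v _ => by simp [w']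
    rw [hKb', Finset.sum_insert hbF] at e1 e2
    exact ⟨w', w' b, by linarith, by rw [← e2, add_comm]⟩
  -- for `β ≥ 0`, a point between the barycentre of the facet and `a` lies in both elements
  have hβ : β < 0 := by
    by_contra! hβ
    obtain ⟨s, hs0, hs1, hs⟩ : ∃ s : ℝ, 0 < s ∧ s ≤ 1 ∧
        ∀ v ∈ F.1, 0 ≤ (1 - s) * (d : ℝ)⁻¹ + s * α v := by
      have hev : ∀ᶠ s in nhdsWithin (0 : ℝ) (Set.Ioi 0),
          ∀ v ∈ F.1, 0 ≤ (1 - s) * (d : ℝ)⁻¹ + s * α v := by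
        rw [Filter.eventually_all_finset]
        intro v _
        have hcont : Continuous fun s : ℝ => (1 - s) * (d : ℝ)⁻¹ + s * α v := by fun_prop
        have h0 : 0 < (1 - (0 : ℝ)) * (d : ℝ)⁻¹ + 0 * α v := by simpa using hd
        have := hcont.continuousAt.eventually (lt_mem_nhds h0)
        exact (this.filter_mono nhdsWithin_le_nhds).mono fun s hs => hs.le
      obtain ⟨s, hs, hs0⟩ := (hev.and (Ioo_mem_nhdsGT (zero_lt_one (α := ℝ)))).exists
      exact ⟨s, hs0.1, hs0.2.le, hs⟩
    have hcF : c ∈ convexHull ℝ (F.1 : Set (E d)) := centroid_mem_convexHull F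
    set z := (1 - s) • c + s • a with hz
    have hz1 : z ∈ convexHull ℝ ((N.fst F).1 : Set (E d)) := by
      refine convex_convexHull ℝ _ (convexHull_mono ?_ hcF) (subset_convexHull ℝ _ ?_)
        (by linarith) hs0.le (by ring)
      · exact_mod_cast N.fst_sub F
      · rw [hKa]; exact Set.mem_insert _ _
    have hz2 : z ∈ convexHull ℝ ((N.snd F).1 : Set (E d)) := by
      have hKb' : (N.snd F).1 = insert b F.1 := by
        apply Finset.coe_injective
        rw [hKb, Finset.coe_insert]
      rw [Finset.mem_convexHull', hKb']
      have hbne : ∀ v ∈ F.1, v ≠ b := fun v hv h => hbF (h ▸ hv)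
      let ω : E d → ℝ := fun v => if v = b then s * β else (1 - s) * (d : ℝ)⁻¹ + s * α v
      have hωb : ω b = s * β := if_pos rfl
      have hωF : ∀ v ∈ F.1, ω v = (1 - s) * (d : ℝ)⁻¹ + s * α v := fun v hv => if_neg (hbne v hv)
      refine ⟨ω, ?_, ?_, ?_⟩
      · intro v hv
        rcases Finset.mem_insert.1 hv with rfl | hv
        · rw [hωb]; positivity
        · rw [hωF v hv]
          exact hs v hv
      · rw [Finset.sum_insert hbF, Finset.sum_congr rfl hωF,
          Finset.sum_add_distrib, ← Finset.mul_sum, ← Finset.mul_sum, Finset.sum_const, F.2.2.1,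
          hωb, nsmul_eq_mul]
        have : (d : ℝ) * ((1 - s) * (d : ℝ)⁻¹) = 1 - s := by field_simp
        linear_combination s * hαβ + this
      · have hsum : ∑ v ∈ F.1, ω v • v
            = ((1 - s) * (d : ℝ)⁻¹) • ∑ v ∈ F.1, v + s • ∑ v ∈ F.1, α v • v := by
          rw [Finset.sum_congr rfl fun v hv => by rw [hωF v hv]]
          simp only [add_smul, Finset.sum_add_distrib, mul_smul, Finset.smul_sum]
        rw [Finset.sum_insert hbF, hsum, hωb, hz, hcS, hab]
        module
    have hz3 := T.complex.inter_subset_convexHull (N.fst F).2.1 (N.snd F).2.1 ⟨hz1, hz2⟩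
    have hint : ((N.fst F).1 : Set (E d)) ∩ (N.snd F).1 = F.1 := by
      have hne : a ≠ b := by
        rintro rfl
        refine N.ne F (Subtype.ext (Finset.coe_injective ?_))
        rw [hKa, hKb]
      rw [hKa, hKb]
      ext v
      simp only [Set.mem_inter_iff, Set.mem_insert_iff, Finset.mem_coe]
      constructor
      · rintro ⟨rfl | h, h'⟩
        · exact h'.resolve_left hne
        · exact h
      · exact fun h => ⟨Or.inr h, Or.inr h⟩
    rw [hint] at hz3
    have hzs := convexHull_subset_affineSpan _ hz3
    have hcs := convexHull_subset_affineSpan _ hcF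
    refine haspan ?_
    have := AffineMap.lineMap_mem (s⁻¹) hcs hzs
    convert this using 1
    rw [AffineMap.lineMap_apply, hz, vsub_eq_sub, vadd_eq_add]
    have h1 : (1 - s) • c + s • a - c = s • (a - c) := by module
    rw [h1, smul_smul, inv_mul_cancel₀ hs0.ne', one_smul, sub_add_cancel]
  -- up to tangential vectors, `a - c` is `β (b - c)`
  have hproj : (vectorSpan ℝ (F.1 : Set (E d)))ᗮ.starProjection (a - c)
      = β • (vectorSpan ℝ (F.1 : Set (E d)))ᗮ.starProjection (b - c) := by
    rw [← map_smul, ← sub_eq_zero, ← map_sub, Submodule.starProjection_apply_eq_zero_iff]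
    refine Submodule.le_orthogonal_orthogonal _ ?_
    have h1 : a - c - β • (b - c) = ∑ v ∈ F.1, α v • (v - c) := by
      simp only [smul_sub, Finset.sum_sub_distrib, ← Finset.sum_smul]
      rw [hab, show ∑ v ∈ F.1, α v = 1 - β by linarith]
      module
    rw [h1]
    refine Submodule.sum_mem _ fun v hv => Submodule.smul_mem _ _ ?_
    exact vsub_mem_vectorSpan_of_mem_affineSpan_of_mem_affineSpan
      (subset_affineSpan ℝ _ hv) (convexHull_subset_affineSpan _ (centroid_mem_convexHull F))
  have hin : inward (N.fst F) F = β • inward (N.snd F) F := by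
    rw [inward_eq_smul hsa, inward_eq_smul hsb, hproj, smul_comm]
  have hβ' : |β|⁻¹ * β = -1 := by
    rw [abs_of_neg hβ, inv_neg, neg_mul, inv_mul_cancel₀ hβ.ne]
  rw [normal, normal, hin, norm_smul, mul_inv, smul_smul, Real.norm_eq_abs,
    mul_right_comm, hβ']
  simp

/-- A facet is a compact subset of a `(d - 1)`-dimensional affine subspace, on which `μHE[d - 1]` is
Lebesgue measure, so its surface measure is finite. -/
instance (F : T.InnerFacet) : IsFiniteMeasure F.surface := by
  constructor
  rw [InnerFacet.surface, Measure.restrict_apply_univ]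
  obtain ⟨p, hp⟩ := F.nonempty
  let V := vectorSpan ℝ (F.1 : Set (E d))
  let f : V → E d := fun v => (v : E d) + p
  have hf : Isometry f := Isometry.of_dist_eq fun v w => by simp [f, Subtype.dist_eq]
  have hsub : convexHull ℝ (F.1 : Set (E d)) ⊆ Set.range f := fun x hx =>
    ⟨⟨x - p, vsub_mem_vectorSpan_of_mem_affineSpan_of_mem_affineSpan
      (convexHull_subset_affineSpan _ hx) (subset_affineSpan ℝ _ hp)⟩, by simp [f]⟩
  have hfin : Module.finrank ℝ V = d - 1 := by
    have h := (T.complex.indep F.2.1).finrank_vectorSpan (n := d - 1)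
      (by rw [Fintype.card_coe, F.2.2.1]; have := F.dim_pos; omega)
    rwa [show Set.range ((↑) : F.1 → E d) = (F.1 : Set (E d)) from Subtype.range_coe] at h
  rw [← Set.image_preimage_eq_of_subset hsub, hf.euclideanHausdorffMeasure_image, ← hfin]
  have hcl : Topology.IsClosedEmbedding f := hf.isClosedEmbedding
  exact (hcl.isCompact_preimage (F.1.finite_toSet.isCompact_convexHull ℝ)).measure_lt_top

theorem InnerFacet.isCompact_convexHull (F : T.InnerFacet) :
    IsCompact (convexHull ℝ (F.1 : Set (E d))) :=
  F.1.finite_toSet.isCompact_convexHull ℝ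

end Mesh

end ConformationalLDG

namespace ConformationalLDG

/-! ### The change of variables and the entropy weights -/

namespace Rates

variable {r : Rates}

theorem u_pos (hP : 0 < r.equiP) (hQ : 0 < r.equiQ) (c : Species) (y : ℝ) : 0 < r.u c y := by
  cases c <;> simp only [u] <;> positivity

theorem u_p_lt (hP : 0 < r.equiP) (y : ℝ) : r.u .p y < r.equiP := by
  simp only [u]
  have : Real.exp y / (1 + Real.exp y) < 1 := by
    rw [div_lt_one (by positivity)]
    linarith
  nlinarith

theorem continuous_u (c : Species) : Continuous (r.u c) := by
  cases c
  · exact continuous_const.mul (Real.continuous_exp.div (by fun_prop) fun y => by positivity)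
  · exact continuous_const.mul Real.continuous_exp

theorem one_sub_u_p_pos (hP : 0 < r.equiP) (y : ℝ) : 0 < 1 - r.equiP⁻¹ * r.u .p y := by
  have h := mul_lt_mul_of_pos_left (u_p_lt hP y) (inv_pos.2 hP)
  rw [inv_mul_cancel₀ hP.ne'] at h
  linarith

theorem entropyDD_u_pos (hP : 0 < r.equiP) (hQ : 0 < r.equiQ) (c : Species) (y : ℝ) :
    0 < r.entropyDD c (r.u c y) := by
  cases c
  · rw [r.entropyDD_p (u_pos hP hQ .p y) (u_p_lt hP y)]
    exact one_div_pos.2 (mul_pos (u_pos hP hQ .p y) (one_sub_u_p_pos hP y))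
  · rw [r.entropyDD_q hQ (u_pos hP hQ .q y)]
    exact one_div_pos.2 (u_pos hP hQ .q y)

theorem continuous_entropyDD_u (hP : 0 < r.equiP) (hQ : 0 < r.equiQ) (c : Species) :
    Continuous fun y => r.entropyDD c (r.u c y) := by
  cases c
  · simp_rw [fun y => r.entropyDD_p (u_pos hP hQ .p y) (u_p_lt hP y)]
    refine continuous_const.div ((continuous_u _).mul
      (continuous_const.sub (continuous_const.mul (continuous_u _)))) fun y => ?_
    exact (mul_pos (u_pos hP hQ .p y) (one_sub_u_p_pos hP y)).ne'
  · simp_rw [fun y => r.entropyDD_q hQ (u_pos hP hQ .q y)]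
    exact continuous_const.div (continuous_u _) fun y => (u_pos hP hQ .q y).ne'

end Rates

/-! ### Integrals of broken functions -/

namespace Mesh

variable {d l : ℕ} {T : Mesh d}

theorem integral_congr {f g : T.Elem → E d → ℝ} (h : ∀ K, ∀ x ∈ K.carrier, f K x = g K x) :
    Mesh.integral f = Mesh.integral g :=
  Finset.sum_congr rfl fun K _ => setIntegral_congr_fun K.measurableSet_carrier (h K)

theorem integral_congr_ae {f g : T.Elem → E d → ℝ}
    (h : ∀ K, f K =ᵐ[volume.restrict K.carrier] g K) : Mesh.integral f = Mesh.integral g :=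
  Finset.sum_congr rfl fun K _ => MeasureTheory.integral_congr_ae (h K)

theorem integral_sum {ι : Type*} (s : Finset ι) (c : ι → ℝ) {g : ι → T.Elem → E d → ℝ}
    (h : ∀ i ∈ s, ∀ K, IntegrableOn (g i K) K.carrier) :
    Mesh.integral (fun K x => ∑ i ∈ s, c i * g i K x) = ∑ i ∈ s, c i * Mesh.integral (g i) := by
  simp only [Mesh.integral, Finset.mul_sum]
  rw [Finset.sum_comm]
  refine Finset.sum_congr rfl fun K _ => ?_
  rw [integral_finsetSum _ fun i hi => (h i hi K).const_mul _]
  simp_rw [integral_const_mul]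

theorem integral_add {f g : T.Elem → E d → ℝ} (hf : ∀ K, IntegrableOn (f K) K.carrier)
    (hg : ∀ K, IntegrableOn (g K) K.carrier) :
    Mesh.integral (fun K x => f K x + g K x) = Mesh.integral f + Mesh.integral g := by
  simp only [Mesh.integral, ← Finset.sum_add_distrib]
  exact Finset.sum_congr rfl fun K _ => MeasureTheory.integral_add (hf K) (hg K)

theorem integral_const_mul (c : ℝ) (f : T.Elem → E d → ℝ) :
    Mesh.integral (fun K x => c * f K x) = c * Mesh.integral f := by
  simp only [Mesh.integral, Finset.mul_sum, MeasureTheory.integral_const_mul]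

theorem integral_mono {f g : T.Elem → E d → ℝ} (hf : ∀ K, IntegrableOn (f K) K.carrier)
    (hg : ∀ K, IntegrableOn (g K) K.carrier) (h : ∀ K, ∀ x ∈ K.carrier, f K x ≤ g K x) :
    Mesh.integral f ≤ Mesh.integral g :=
  Finset.sum_le_sum fun K _ => setIntegral_mono_on (hf K) (hg K) K.measurableSet_carrier (h K)

theorem Elem.integrableOn_of_continuous {f : E d → ℝ} (hf : Continuous f) (K : T.Elem) :
    IntegrableOn f K.carrier :=
  hf.continuousOn.integrableOn_compact K.isCompact_carrier

theorem Elem.setIntegral_pos {K : T.Elem} {f : E d → ℝ} (hf : Continuous f)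
    (h0 : ∀ x ∈ K.carrier, 0 ≤ f x) {x : E d} (hx : x ∈ K.carrier) (hfx : 0 < f x) :
    0 < ∫ y in K.carrier, f y := by
  rw [setIntegral_pos_iff_support_of_nonneg_ae
    ((ae_restrict_iff' K.measurableSet_carrier).2 (Filter.Eventually.of_forall h0))
    (K.integrableOn_of_continuous hf)]
  have hU : IsOpen (interior K.carrier ∩ {y | 0 < f y}) :=
    isOpen_interior.inter (isOpen_lt continuous_const hf)
  have hne : (interior K.carrier ∩ {y | 0 < f y}).Nonempty := by
    have := mem_closure_iff.1 (K.carrier_subset_closure_interior hx) _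
      (isOpen_lt continuous_const hf) hfx
    rwa [Set.inter_comm] at this
  refine (hU.measure_pos volume hne).trans_le (measure_mono ?_)
  exact fun y hy => ⟨(ne_of_gt hy.2 : f y ≠ 0), interior_subset hy.1⟩

theorem Elem.eq_zero_of_eval_eq_zero {K : T.Elem} {P : MvPolynomial (Fin d) ℝ}
    (h : ∀ x ∈ K.carrier, MvPolynomial.eval (fun i => x i) P = 0) : P = 0 := by
  obtain ⟨x, hx⟩ := K.interior_carrier_nonempty
  have hopen : IsOpen ((fun y : Fin d → ℝ => (WithLp.toLp 2 y : E d)) ⁻¹' interior K.carrier) :=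
    isOpen_interior.preimage (by fun_prop)
  obtain ⟨ε, hε, hball⟩ := Metric.isOpen_iff.1 hopen x.ofLp hx
  refine MvPolynomial.funext_set (fun i => Metric.ball (x i) ε) (fun i => ?_) fun y hy => ?_
  · rw [Real.ball_eq_Ioo]
    exact Set.Ioo_infinite (by linarith)
  · rw [map_zero]
    have hy' : y ∈ Metric.ball x.ofLp ε := by rwa [ball_pi _ hε]
    exact h (WithLp.toLp 2 y) (interior_subset (hball hy'))

theorem continuous_eval (P : MvPolynomial (Fin d) ℝ) :
    Continuous fun x : E d => MvPolynomial.eval (fun i => x i) P :=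
  P.continuous_eval.comp (by fun_prop)

theorem continuous_evalW (w : T.W l) (K : T.Elem) : Continuous (evalW w K) := continuous_eval _

theorem continuous_evalR (φ : T.R l) (K : T.Elem) : Continuous (evalR φ K) :=
  continuous_pi fun _ => continuous_eval _

theorem continuous_gradW (w : T.W l) (K : T.Elem) : Continuous (gradW w K) :=
  continuous_pi fun _ => continuous_eval _

theorem evalW_sum {ι : Type*} (s : Finset ι) (a : ι → ℝ) (b : ι → T.W l) (K : T.Elem) (x : E d) :
    evalW (∑ i ∈ s, a i • b i) K x = ∑ i ∈ s, a i * evalW (b i) K x := by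
  simp [evalW, Finset.sum_apply, map_sum, MvPolynomial.smul_eval]

theorem evalR_sum {ι : Type*} (s : Finset ι) (a : ι → ℝ) (b : ι → T.R l) (K : T.Elem) (x : E d) :
    evalR (∑ i ∈ s, a i • b i) K x = ∑ i ∈ s, a i • evalR (b i) K x := by
  ext k
  simp [evalR, Finset.sum_apply, map_sum, MvPolynomial.smul_eval]

theorem gradW_sum {ι : Type*} (s : Finset ι) (a : ι → ℝ) (b : ι → T.W l) (K : T.Elem) (x : E d) :
    gradW (∑ i ∈ s, a i • b i) K x = ∑ i ∈ s, a i • gradW (b i) K x := by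
  ext k
  simp [gradW, Finset.sum_apply, map_sum, MvPolynomial.smul_eval]

/-- The constant function `1` as a broken polynomial. -/
noncomputable def oneW (T : Mesh d) (l : ℕ) : T.W l :=
  fun _ => ⟨1, by simp [MvPolynomial.mem_restrictTotalDegree]⟩

theorem evalW_oneW (K : T.Elem) (x : E d) : evalW (oneW T l) K x = 1 := by simp [evalW, oneW]

theorem gradW_oneW (K : T.Elem) (x : E d) : gradW (oneW T l) K x = 0 := by
  ext i
  have : MvPolynomial.pderiv i (1 : MvPolynomial (Fin d) ℝ) = 0 :=
    (MvPolynomial.pderiv i).map_one_eq_zero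
  simp [gradW, oneW, this]

/-! ### Integrals over facets and quadratic forms -/

theorem InnerFacet.integrable_mul_continuous {F : T.InnerFacet} {f g : E d → ℝ}
    (hf : Integrable f F.surface) (hg : Continuous g) :
    Integrable (fun x => f x * g x) F.surface := by
  have hF : F.surface.restrict (convexHull ℝ (F.1 : Set (E d))) = F.surface := by
    rw [InnerFacet.surface, Measure.restrict_restrict F.isCompact_convexHull.isClosed.measurableSet,
      Set.inter_self]
  have h : IntegrableOn (fun x => f x * g x) (convexHull ℝ (F.1 : Set (E d))) F.surface :=
    IntegrableOn.mul_continuousOn (by rwa [IntegrableOn, hF]) hg.continuousOn F.isCompact_convexHull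
  rwa [IntegrableOn, hF] at h

theorem InnerFacet.integrable_of_continuous {F : T.InnerFacet} {g : E d → ℝ} (hg : Continuous g) :
    Integrable g F.surface := by
  simpa using integrable_mul_continuous (integrable_const (μ := F.surface) (1 : ℝ)) hg

end Mesh

theorem IsDiffusionTensor.mono {d : ℕ} {μ ν : Measure (E d)} {A : E d → Matrix (Fin d) (Fin d) ℝ}
    {c : ℝ} (h : IsDiffusionTensor μ A c) (hν : ν ≤ μ) : IsDiffusionTensor ν A c where
  memLp i j := (h.memLp i j).mono_measure hν
  symm := ae_mono hν h.symm
  coercive := ae_mono hν h.coercive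

theorem dotProduct_mulVec_eq_sum {ι κ : Type*} [Fintype ι] [Fintype κ] (A : Matrix ι κ ℝ)
    (v : ι → ℝ) (w : κ → ℝ) : v ⬝ᵥ (A *ᵥ w) = ∑ p : ι × κ, (v p.1 * w p.2) * A p.1 p.2 := by
  simp only [dotProduct, mulVec, Finset.mul_sum, Fintype.sum_prod_type]
  exact Finset.sum_congr rfl fun i _ => Finset.sum_congr rfl fun j _ => by ring

theorem sum_smul_dotProduct_sum_smul {ι κ n : Type*} [Fintype ι] [Fintype κ] [Fintype n]
    (v : ι → ℝ) (w : κ → ℝ) (a : ι → n → ℝ) (b : κ → n → ℝ) :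
    (∑ j, w j • b j) ⬝ᵥ (∑ i, v i • a i) = ∑ p : ι × κ, (v p.1 * w p.2) * (b p.2 ⬝ᵥ a p.1) := by
  rw [Fintype.sum_prod_type]
  simp only [dotProduct_sum, sum_dotProduct, smul_dotProduct, dotProduct_smul, smul_eq_mul,
    Finset.mul_sum]
  exact Finset.sum_congr rfl fun i _ => Finset.sum_congr rfl fun j _ => by ring

end ConformationalLDG

namespace ConformationalLDG

namespace Scheme

variable {d l : ℕ} {ιW ιR : Type*} {S : Scheme d l ιW ιR}

theorem zero_le_dotProduct_self {n : Type*} [Fintype n] (v : n → ℝ) : 0 ≤ v ⬝ᵥ v :=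
  Finset.sum_nonneg fun i _ => mul_self_nonneg (v i)

/-! ### Weighted integrals and forms of the diffusion tensor -/

theorem integrableOn_diffusion {c : ℝ}
    (hD : IsDiffusionTensor (volume.restrict S.T.domain) S.D c) (K : S.T.Elem)
    {g : E d → ℝ} (hg : Continuous g) {z φ : E d → Fin d → ℝ} (hz : Continuous z)
    (hφ : Continuous φ) :
    IntegrableOn (fun x => g x * ((S.D x *ᵥ z x) ⬝ᵥ φ x)) K.carrier := by
  have hK := hD.mono K.restrict_carrier_le
  have : IsFiniteMeasure (volume.restrict K.carrier) :=
    ⟨by simpa using K.isCompact_carrier.measure_lt_top⟩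
  have heq : (fun x => g x * ((S.D x *ᵥ z x) ⬝ᵥ φ x))
      = fun x => ∑ i, ∑ j, S.D x i j * (g x * z x j * φ x i) := by
    ext x
    simp only [dotProduct, mulVec, Finset.mul_sum, Finset.sum_mul]
    exact Finset.sum_congr rfl fun i _ => Finset.sum_congr rfl fun j _ => by ring
  rw [heq]
  refine integrable_finsetSum _ fun i _ => integrable_finsetSum _ fun j _ => ?_
  have h1 : IntegrableOn (fun x => S.D x i j) K.carrier := (hK.memLp i j).integrable le_top
  refine h1.mul_continuousOn (Continuous.continuousOn ?_) K.isCompact_carrier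
  exact (hg.mul ((continuous_apply j).comp hz)).mul ((continuous_apply i).comp hφ)

variable (S) in
/-- The vector-valued broken polynomial with coefficient vector `v`. -/
noncomputable def fnR [Fintype ιR] (v : ιR → ℝ) : S.T.R l := ∑ i, v i • S.basisR i

theorem dotProduct_matN_mulVec [Fintype ιW] [Fintype ιR]
    (hP : 0 < S.rates.equiP) (hQ : 0 < S.rates.equiQ) {c : ℝ}
    (hD : IsDiffusionTensor (volume.restrict S.T.domain) S.D c) (a : Species) (w : ιW → ℝ)
    (v : ιR → ℝ) :
    v ⬝ᵥ (S.matN a w *ᵥ v) = S.nForm a (S.fn w) (S.fnR v) (S.fnR v) := by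
  rw [dotProduct_mulVec_eq_sum, nForm, fnR]
  simp only [matN, of_apply, nForm]
  rw [← Mesh.integral_sum (g := fun (p : ιR × ιR) K x =>
    S.rates.entropyDD a (S.rates.u a (Mesh.evalW (S.fn w) K x)) *
      ((S.D x *ᵥ Mesh.evalR (S.basisR p.2) K x) ⬝ᵥ Mesh.evalR (S.basisR p.1) K x))
    Finset.univ _ fun p _ K => integrableOn_diffusion hD K
    ((Rates.continuous_entropyDD_u hP hQ a).comp (Mesh.continuous_evalW _ K))
    (Mesh.continuous_evalR _ K) (Mesh.continuous_evalR _ K)]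
  refine Mesh.integral_congr fun K x _ => ?_
  rw [Mesh.evalR_sum, mulVec_sum]
  simp only [mulVec_smul]
  rw [sum_smul_dotProduct_sum_smul, Finset.mul_sum]
  exact Finset.sum_congr rfl fun p _ => by ring

/-- The matrix `N_⋆(W)` is positive definite. -/
theorem dotProduct_matN_mulVec_pos [Fintype ιW] [Fintype ιR]
    (hP : 0 < S.rates.equiP) (hQ : 0 < S.rates.equiQ) {c : ℝ}
    (hc : 0 < c) (hD : IsDiffusionTensor (volume.restrict S.T.domain) S.D c) (a : Species)
    (w : ιW → ℝ) {v : ιR → ℝ} (hv : v ≠ 0) : 0 < v ⬝ᵥ (S.matN a w *ᵥ v) := by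
  rw [dotProduct_matN_mulVec hP hQ hD, nForm]
  set ζ : S.T.Elem → E d → ℝ :=
    fun K x => S.rates.entropyDD a (S.rates.u a (Mesh.evalW (S.fn w) K x)) with hζ
  have hζc : ∀ K, Continuous (ζ K) := fun K =>
    (Rates.continuous_entropyDD_u hP hQ a).comp (Mesh.continuous_evalW _ K)
  have hζp : ∀ K x, 0 < ζ K x := fun K x => Rates.entropyDD_u_pos hP hQ a _
  set φ := S.fnR v with hφ
  have hφc : ∀ K, Continuous fun x => ζ K x * (c * (Mesh.evalR φ K x ⬝ᵥ Mesh.evalR φ K x)) :=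
    fun K => (hζc K).mul (continuous_const.mul
      ((Mesh.continuous_evalR φ K).dotProduct (Mesh.continuous_evalR φ K)))
  have hnn : ∀ K x, 0 ≤ ζ K x * (c * (Mesh.evalR φ K x ⬝ᵥ Mesh.evalR φ K x)) := fun K x =>
    mul_nonneg (hζp K x).le (mul_nonneg hc.le (zero_le_dotProduct_self _))
  have hle : Mesh.integral (fun K x => ζ K x * (c * (Mesh.evalR φ K x ⬝ᵥ Mesh.evalR φ K x)))
      ≤ Mesh.integral fun K x => ζ K x * ((S.D x *ᵥ Mesh.evalR φ K x) ⬝ᵥ Mesh.evalR φ K x) := by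
    refine Finset.sum_le_sum fun K _ => integral_mono_ae
      (K.integrableOn_of_continuous (hφc K))
      (integrableOn_diffusion hD K (hζc K) (Mesh.continuous_evalR φ K)
        (Mesh.continuous_evalR φ K)) ?_
    filter_upwards [(hD.mono K.restrict_carrier_le).coercive] with x hx
    refine mul_le_mul_of_nonneg_left ?_ (hζp K x).le
    rw [dotProduct_comm (S.D x *ᵥ _)]
    exact hx _
  refine lt_of_lt_of_le ?_ hle
  have hφ0 : φ ≠ 0 := by
    intro h0
    apply hv
    have := Fintype.linearIndependent_iff.1 S.basisR.linearIndependent v h0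
    exact funext this
  obtain ⟨K, hK⟩ := Function.ne_iff.1 hφ0
  obtain ⟨i, hi⟩ := Function.ne_iff.1 hK
  obtain ⟨x, hx, hx0⟩ : ∃ x ∈ K.carrier, MvPolynomial.eval (fun j => x j) (φ K i).1 ≠ 0 := by
    by_contra! h
    exact hi (Subtype.ext (Mesh.Elem.eq_zero_of_eval_eq_zero h))
  refine Finset.sum_pos' (fun K _ => setIntegral_nonneg K.measurableSet_carrier fun x _ => hnn K x)
    ⟨K, Finset.mem_univ _, Mesh.Elem.setIntegral_pos (hφc K) (fun x _ => hnn K x) hx ?_⟩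
  refine mul_pos (hζp K x) (mul_pos hc ?_)
  refine lt_of_le_of_ne (zero_le_dotProduct_self _) (Ne.symm ?_)
  rw [Ne, dotProduct_self_eq_zero]
  exact fun h => hx0 (congrFun h i)

theorem isUnit_matN [Fintype ιW] [Fintype ιR] [DecidableEq ιR]
    (hP : 0 < S.rates.equiP) (hQ : 0 < S.rates.equiQ) {c : ℝ}
    (hc : 0 < c) (hD : IsDiffusionTensor (volume.restrict S.T.domain) S.D c) (a : Species)
    (w : ιW → ℝ) : IsUnit (S.matN a w) := by
  rw [← Matrix.mulVec_injective_iff_isUnit]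
  refine (injective_iff_map_eq_zero (S.matN a w).mulVecLin).2 fun v hv => ?_
  by_contra hne
  have := dotProduct_matN_mulVec_pos hP hQ hc hD a w hne
  rw [show S.matN a w *ᵥ v = 0 from hv, dotProduct_zero] at this
  exact this.false

theorem matM_isSymm : S.matMᵀ = S.matM := by
  ext i j
  simp only [matM, transpose_apply, of_apply, mForm]
  exact Mesh.integral_congr fun K x _ => dotProduct_comm _ _

theorem matD_isSymm {c : ℝ} (hD : IsDiffusionTensor (volume.restrict S.T.domain) S.D c) :
    S.matDᵀ = S.matD := by
  ext i j
  simp only [matD, transpose_apply, of_apply, dForm]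
  refine Mesh.integral_congr_ae fun K => ?_
  filter_upwards [(hD.mono K.restrict_carrier_le).symm] with x hx
  rw [dotProduct_comm (S.D x *ᵥ Mesh.evalR (S.basisR j) K x), dotProduct_mulVec, ← mulVec_transpose,
    hx.eq]

/-! ### The jumps and the facet terms -/

theorem fn_repr [Fintype ιW] (w : S.T.W l) : S.fn (S.basisW.repr w) = w := S.basisW.sum_repr w

variable (S) in
/-- The coefficient vector of the constant function `1`. -/
noncomputable def one : ιW → ℝ := S.basisW.repr (Mesh.oneW S.T l)

theorem fn_one [Fintype ιW] : S.fn S.one = Mesh.oneW S.T l := fn_repr _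

theorem continuous_jump (w : S.T.W l) (F : S.T.InnerFacet) : Continuous (S.jump w F) :=
  continuous_pi fun _ => ((Mesh.continuous_evalW _ _).mul continuous_const).add
    ((Mesh.continuous_evalW _ _).mul continuous_const)

theorem continuous_mean (φ : S.T.R l) (F : S.T.InnerFacet) : Continuous (S.mean φ F) :=
  ((Mesh.continuous_evalR φ (S.num.fst F)).const_smul (S.gamma F)).add
    ((Mesh.continuous_evalR φ (S.num.snd F)).const_smul (1 - S.gamma F))

theorem jump_sum {ι : Type*} (s : Finset ι) (a : ι → ℝ) (b : ι → S.T.W l) (F : S.T.InnerFacet)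
    (x : E d) : S.jump (∑ i ∈ s, a i • b i) F x = ∑ i ∈ s, a i • S.jump (b i) F x := by
  ext k
  simp only [jump, Mesh.evalW_sum, Finset.sum_apply, Pi.smul_apply, smul_eq_mul, Finset.sum_mul,
    ← Finset.sum_add_distrib]
  exact Finset.sum_congr rfl fun i _ => by ring

theorem jump_one (F : S.T.InnerFacet) (x : E d) : S.jump (Mesh.oneW S.T l) F x = 0 := by
  ext i
  simp [jump, Mesh.evalW_oneW, Mesh.normal_snd_eq_neg_normal_fst S.num F]

theorem bForm_sum {ι : Type*} (s : Finset ι) (a : ι → ℝ) (b : ι → S.T.W l) (φ : S.T.R l) :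
    S.bForm (∑ i ∈ s, a i • b i) φ = ∑ i ∈ s, a i * S.bForm (b i) φ := by
  simp only [bForm, mul_sub, Finset.sum_sub_distrib]
  congr 1
  · rw [← Mesh.integral_sum _ _ fun i _ K => K.integrableOn_of_continuous
      ((Mesh.continuous_gradW _ K).dotProduct (Mesh.continuous_evalR φ K))]
    refine Mesh.integral_congr fun K x _ => ?_
    rw [Mesh.gradW_sum, sum_dotProduct]
    simp only [smul_dotProduct, smul_eq_mul]
  · simp only [Finset.mul_sum]
    rw [Finset.sum_comm]
    refine Finset.sum_congr rfl fun F _ => ?_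
    simp_rw [← integral_const_mul]
    rw [← integral_finsetSum _ fun i _ => (Mesh.InnerFacet.integrable_of_continuous
      ((continuous_jump _ F).dotProduct (continuous_mean φ F))).const_mul _]
    refine integral_congr_ae (Filter.Eventually.of_forall fun x => ?_)
    simp only [jump_sum, sum_dotProduct, smul_dotProduct, smul_eq_mul]

theorem matB_mulVec_one [Fintype ιW] : S.matB *ᵥ S.one = 0 := by
  ext i
  have h : (S.matB *ᵥ S.one) i = S.bForm (S.fn S.one) (S.basisR i) := by
    rw [fn, bForm_sum]
    simp only [mulVec, dotProduct, matB, of_apply]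
    exact Finset.sum_congr rfl fun j _ => mul_comm _ _
  rw [h, fn_one, bForm]
  simp [Mesh.gradW_oneW, jump_one, Mesh.integral]

theorem normalD_nonneg {c : ℝ} (hc : 0 < c) {F : S.T.InnerFacet} {K : S.T.Elem} {x : E d}
    (h : ∀ z : Fin d → ℝ, c * (z ⬝ᵥ z) ≤ z ⬝ᵥ (S.trD K x *ᵥ z)) : 0 ≤ S.normalD F K x :=
  (mul_nonneg hc.le (zero_le_dotProduct_self _)).trans (h _)

theorem eta_nonneg {F : S.T.InnerFacet} {x : E d} (h0 : 0 ≤ S.eta0)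
    (h1 : 0 ≤ S.normalD F (S.num.fst F) x) (h2 : 0 ≤ S.normalD F (S.num.snd F) x) :
    0 ≤ S.eta F x := by
  unfold eta
  positivity

theorem memLp_normalD {c : ℝ} {F : S.T.InnerFacet} {K : S.T.Elem}
    (h : IsDiffusionTensor F.surface (S.trD K) c) : MemLp (S.normalD F K) ⊤ F.surface := by
  have heq : S.normalD F K = fun x => ∑ i, ∑ j,
      (Mesh.normal K F i * Mesh.normal K F j) * S.trD K x i j := by
    ext x
    simp only [normalD, dotProduct, mulVec, Finset.mul_sum]
    exact Finset.sum_congr rfl fun i _ => Finset.sum_congr rfl fun j _ => by ring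
  rw [heq]
  exact memLp_finsetSum _ fun i _ => memLp_finsetSum _ fun j _ => (h.memLp i j).const_mul _

/-- The harmonic mean of the two normal diffusivities is at most twice the first of them, so that
the stability parameter is bounded. -/
theorem integrable_eta {c : ℝ} (hc : 0 < c)
    (htrD : ∀ (F : S.T.InnerFacet) (K : S.T.Elem), F.1 ⊆ K.1 →
      IsDiffusionTensor F.surface (S.trD K) c) (F : S.T.InnerFacet) :
    Integrable (S.eta F) F.surface := by
  have h1 := htrD F _ (S.num.fst_sub F)
  have h2 := htrD F _ (S.num.snd_sub F)
  have m1 := memLp_normalD h1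
  have m2 := memLp_normalD h2
  refine Integrable.const_mul ?_ _
  refine Integrable.mono' ((m1.integrable le_top).const_mul 2) ?_ ?_
  · exact (((m1.aestronglyMeasurable.aemeasurable.const_mul 2).mul
      m2.aestronglyMeasurable.aemeasurable).div (m1.aestronglyMeasurable.aemeasurable.add
        m2.aestronglyMeasurable.aemeasurable)).aestronglyMeasurable
  · filter_upwards [h1.coercive, h2.coercive] with x hx1 hx2
    have a1 := normalD_nonneg (F := F) hc hx1
    have a2 := normalD_nonneg (F := F) hc hx2
    rw [Real.norm_of_nonneg (by positivity)]
    refine div_le_of_le_mul₀ (by positivity) (by positivity) ?_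
    nlinarith [mul_nonneg a1 a1]

theorem integrable_jForm {c : ℝ} (hc : 0 < c)
    (htrD : ∀ (F : S.T.InnerFacet) (K : S.T.Elem), F.1 ⊆ K.1 →
      IsDiffusionTensor F.surface (S.trD K) c) (F : S.T.InnerFacet) (w ψ : S.T.W l) :
    Integrable (fun x => S.eta F x * (S.meshSize F)⁻¹ * (S.jump w F x ⬝ᵥ S.jump ψ F x))
      F.surface :=
  Mesh.InnerFacet.integrable_mul_continuous ((integrable_eta hc htrD F).mul_const _)
    ((continuous_jump w F).dotProduct (continuous_jump ψ F))

theorem dotProduct_matJ_mulVec [Fintype ιW] {c : ℝ} (hc : 0 < c)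
    (htrD : ∀ (F : S.T.InnerFacet) (K : S.T.Elem), F.1 ⊆ K.1 →
      IsDiffusionTensor F.surface (S.trD K) c) (v w : ιW → ℝ) :
    v ⬝ᵥ (S.matJ *ᵥ w) = S.jForm (S.fn w) (S.fn v) := by
  rw [dotProduct_mulVec_eq_sum]
  simp only [matJ, of_apply, jForm, Finset.mul_sum]
  rw [Finset.sum_comm]
  refine Finset.sum_congr rfl fun F _ => ?_
  simp_rw [← integral_const_mul]
  rw [← integral_finsetSum _ fun p _ => (integrable_jForm hc htrD F _ _).const_mul _]
  refine integral_congr_ae (Filter.Eventually.of_forall fun x => ?_)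
  simp only [fn, jump_sum]
  rw [sum_smul_dotProduct_sum_smul, Finset.mul_sum]
  exact Finset.sum_congr rfl fun p _ => by ring

theorem dotProduct_matJ_mulVec_nonneg [Fintype ιW] (h0 : 0 ≤ S.eta0) {c : ℝ} (hc : 0 < c)
    (htrD : ∀ (F : S.T.InnerFacet) (K : S.T.Elem), F.1 ⊆ K.1 →
      IsDiffusionTensor F.surface (S.trD K) c) (w : ιW → ℝ) : 0 ≤ w ⬝ᵥ (S.matJ *ᵥ w) := by
  rw [dotProduct_matJ_mulVec hc htrD, jForm]
  refine Finset.sum_nonneg fun F _ => integral_nonneg_of_ae ?_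
  filter_upwards [(htrD F _ (S.num.fst_sub F)).coercive, (htrD F _ (S.num.snd_sub F)).coercive]
    with x hx1 hx2
  refine mul_nonneg (mul_nonneg (eta_nonneg h0 (normalD_nonneg hc hx1) (normalD_nonneg hc hx2))
    (inv_nonneg.2 (le_min Metric.diam_nonneg Metric.diam_nonneg))) (zero_le_dotProduct_self _)

theorem one_dotProduct_matJ_mulVec [Fintype ιW] {c : ℝ} (hc : 0 < c)
    (htrD : ∀ (F : S.T.InnerFacet) (K : S.T.Elem), F.1 ⊆ K.1 →
      IsDiffusionTensor F.surface (S.trD K) c) (w : ιW → ℝ) : S.one ⬝ᵥ (S.matJ *ᵥ w) = 0 := by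
  rw [dotProduct_matJ_mulVec hc htrD, fn_one, jForm]
  simp [jump_one]

end Scheme

end ConformationalLDG

namespace ConformationalLDG

theorem Mesh.Elem.continuous_setIntegral_mul {d : ℕ} {T : Mesh d} {X : Type*} [TopologicalSpace X]
    [LocallyCompactSpace X] [FirstCountableTopology X] (K : T.Elem) {g : E d → ℝ}
    (hg : IntegrableOn g K.carrier) {h : X → E d → ℝ} (hh : Continuous (Function.uncurry h)) :
    Continuous fun p => ∫ x in K.carrier, h p x * g x := by
  refine continuous_iff_continuousAt.2 fun p => ?_
  obtain ⟨N, hN, hNp⟩ := exists_compact_mem_nhds p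
  obtain ⟨C, hC⟩ := (hN.prod K.isCompact_carrier).exists_bound_of_continuousOn hh.continuousOn
  refine continuousAt_of_dominated (bound := fun x => C * |g x|) ?_ ?_ (hg.norm.const_mul C) ?_
  · refine Filter.Eventually.of_forall fun q => ?_
    exact (hh.comp (Continuous.prodMk_right q)).aestronglyMeasurable.mul hg.aestronglyMeasurable
  · filter_upwards [hNp] with q hq
    filter_upwards [ae_restrict_mem K.measurableSet_carrier] with x hx
    rw [norm_mul, Real.norm_eq_abs (g x)]
    exact mul_le_mul_of_nonneg_right (hC (q, x) ⟨hq, hx⟩) (abs_nonneg _)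
  · exact Filter.Eventually.of_forall fun x =>
      ((hh.comp (Continuous.prodMk_left x)).mul continuous_const).continuousAt

theorem Rates.continuous_uncurry_f (r : Rates) (c : Species) :
    Continuous fun z : ℝ × ℝ => r.f c z.1 z.2 := by
  cases c <;> (simp only [Rates.f]; fun_prop)

namespace Scheme

variable {d l : ℕ} {ιW ιR : Type*} {S : Scheme d l ιW ιR}

/-! ### Continuity of the nonlinear operators -/

theorem continuous_evalW_fn [Fintype ιW] (K : S.T.Elem) :
    Continuous fun z : (ιW → ℝ) × E d => Mesh.evalW (S.fn z.1) K z.2 := by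
  simp only [fn, Mesh.evalW_sum]
  exact continuous_finsetSum _ fun i _ => ((continuous_apply i).comp continuous_fst).mul
    ((Mesh.continuous_evalW _ K).comp continuous_snd)

theorem continuous_evalW_fn_comp [Fintype ιW] {X : Type*} [TopologicalSpace X] {a : X → ιW → ℝ}
    {b : X → E d} (ha : Continuous a) (hb : Continuous b) (K : S.T.Elem) :
    Continuous fun y => Mesh.evalW (S.fn (a y)) K (b y) :=
  (continuous_evalW_fn (S := S) K).comp (f := fun y => (a y, b y)) (ha.prodMk hb)

theorem continuous_vecU [Fintype ιW] (c : Species) : Continuous (S.vecU c) := by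
  refine continuous_pi fun i => continuous_finsetSum _ fun K _ => ?_
  exact K.continuous_setIntegral_mul (h := fun w x => S.rates.u c (Mesh.evalW (S.fn w) K x))
    (K.integrableOn_of_continuous (Mesh.continuous_evalW _ K))
    ((Rates.continuous_u c).comp (continuous_evalW_fn K))

theorem continuous_reaction_comp [Fintype ιW] {X : Type*} [TopologicalSpace X]
    {a a' : X → ιW → ℝ} {b : X → E d} (ha : Continuous a) (ha' : Continuous a')
    (hb : Continuous b) (c : Species) (K : S.T.Elem) :
    Continuous fun y => S.rates.f c (S.rates.u .p (Mesh.evalW (S.fn (a y)) K (b y)))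
      (S.rates.u .q (Mesh.evalW (S.fn (a' y)) K (b y))) :=
  (Rates.continuous_uncurry_f S.rates c).comp
    (((Rates.continuous_u .p).comp (continuous_evalW_fn_comp ha hb K)).prodMk
      ((Rates.continuous_u .q).comp (continuous_evalW_fn_comp ha' hb K)))

theorem continuous_vecF [Fintype ιW] (c : Species) :
    Continuous fun z : (ιW → ℝ) × (ιW → ℝ) => S.vecF c z.1 z.2 := by
  refine continuous_pi fun i => continuous_finsetSum _ fun K _ => ?_
  exact K.continuous_setIntegral_mul
    (h := fun (z : (ιW → ℝ) × (ιW → ℝ)) (x : E d) => S.rates.f c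
      (S.rates.u .p (Mesh.evalW (S.fn z.1) K x)) (S.rates.u .q (Mesh.evalW (S.fn z.2) K x)))
    (K.integrableOn_of_continuous (Mesh.continuous_evalW (S.basisW i) K))
    (continuous_reaction_comp (continuous_fst.comp continuous_fst)
      (continuous_snd.comp continuous_fst) continuous_snd c K)

theorem continuous_matN [Fintype ιW] (hP : 0 < S.rates.equiP) (hQ : 0 < S.rates.equiQ) {c : ℝ}
    (hD : IsDiffusionTensor (volume.restrict S.T.domain) S.D c) (a : Species) :
    Continuous (S.matN a) := by
  refine continuous_matrix fun i j => continuous_finsetSum _ fun K _ => ?_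
  refine K.continuous_setIntegral_mul
    (h := fun w x => S.rates.entropyDD a (S.rates.u a (Mesh.evalW (S.fn w) K x))) ?_
    ((Rates.continuous_entropyDD_u hP hQ a).comp (continuous_evalW_fn K))
  simpa using integrableOn_diffusion hD K (continuous_const (y := (1 : ℝ)))
    (Mesh.continuous_evalR (S.basisR j) K) (Mesh.continuous_evalR (S.basisR i) K)

section Flux

variable [Fintype ιW] [Fintype ιR] [DecidableEq ιR]

variable (S) in
/-- The coefficient vector `Σ_⋆` that the first equation of the system determines from `W_⋆`. -/
noncomputable def sigma (a : Species) (w : ιW → ℝ) : ιR → ℝ :=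
  -((S.matN a w)⁻¹ *ᵥ (S.matD *ᵥ (S.matM⁻¹ *ᵥ (S.matB *ᵥ w))))

variable (S) in
/-- The diffusive term of the second equation of the system, after elimination of `Σ_⋆`. -/
noncomputable def diffusion (a : Species) (w : ιW → ℝ) : ιW → ℝ :=
  -(S.matBᵀ *ᵥ (S.matM⁻¹ *ᵥ (S.matD *ᵥ S.sigma a w)))

theorem matN_mulVec_sigma (hP : 0 < S.rates.equiP) (hQ : 0 < S.rates.equiQ) {c : ℝ} (hc : 0 < c)
    (hD : IsDiffusionTensor (volume.restrict S.T.domain) S.D c) (a : Species) (w : ιW → ℝ) :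
    S.matN a w *ᵥ S.sigma a w = -(S.matD *ᵥ (S.matM⁻¹ *ᵥ (S.matB *ᵥ w))) := by
  rw [sigma, mulVec_neg, mulVec_mulVec, mul_nonsing_inv _
    ((isUnit_iff_isUnit_det _).1 (isUnit_matN hP hQ hc hD a w)), one_mulVec]

theorem continuous_diffusion (hP : 0 < S.rates.equiP) (hQ : 0 < S.rates.equiQ) {c : ℝ} (hc : 0 < c)
    (hD : IsDiffusionTensor (volume.restrict S.T.domain) S.D c) (a : Species) :
    Continuous (S.diffusion a) := by
  have hN := continuous_matN hP hQ hD a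
  have hinv : Continuous fun w => (S.matN a w)⁻¹ := by
    simp only [inv_def, Ring.inverse_eq_inv']
    exact (hN.matrix_det.inv₀ fun w => ((isUnit_iff_isUnit_det _).1
      (isUnit_matN hP hQ hc hD a w)).ne_zero).smul hN.matrix_adjugate
  unfold diffusion sigma
  exact (continuous_const.matrix_mulVec (continuous_const.matrix_mulVec
    (continuous_const.matrix_mulVec (hinv.matrix_mulVec (continuous_const.matrix_mulVec
      (continuous_const.matrix_mulVec (continuous_const.matrix_mulVec continuous_id)))).neg))).neg

theorem dotProduct_diffusion (v : ιW → ℝ) (a : Species) (w : ιW → ℝ) :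
    v ⬝ᵥ S.diffusion a w
      = -((S.matM⁻¹ *ᵥ (S.matB *ᵥ v)) ⬝ᵥ (S.matD *ᵥ S.sigma a w)) := by
  have hM : (S.matM⁻¹)ᵀ = S.matM⁻¹ := by rw [transpose_nonsing_inv, matM_isSymm]
  rw [diffusion, dotProduct_neg, dotProduct_mulVec, vecMul_transpose, dotProduct_mulVec,
    ← mulVec_transpose, hM]

theorem one_dotProduct_diffusion (a : Species) (w : ιW → ℝ) :
    S.one ⬝ᵥ S.diffusion a w = 0 := by
  rw [dotProduct_diffusion, matB_mulVec_one, mulVec_zero, zero_dotProduct, neg_zero]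

/-- The diffusive term dissipates: tested with `W`, it is `Σᵀ N_⋆(W) Σ`. -/
theorem dotProduct_diffusion_self_nonneg (hP : 0 < S.rates.equiP) (hQ : 0 < S.rates.equiQ) {c : ℝ}
    (hc : 0 < c) (hD : IsDiffusionTensor (volume.restrict S.T.domain) S.D c) (a : Species)
    (w : ιW → ℝ) : 0 ≤ w ⬝ᵥ S.diffusion a w := by
  rw [dotProduct_diffusion, dotProduct_mulVec, ← mulVec_transpose, matD_isSymm hD, ← neg_dotProduct,
    ← matN_mulVec_sigma hP hQ hc hD, dotProduct_comm]
  rcases eq_or_ne (S.sigma a w) 0 with h | h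
  · simp [h]
  · exact (dotProduct_matN_mulVec_pos hP hQ hc hD a w h).le

end Flux

/-! ### The nonlinear operators, tested with a function -/

theorem sum_mul_integral_mul_basisW [Fintype ιW] {g : S.T.Elem → E d → ℝ}
    (hg : ∀ K, Continuous (g K)) (v : ιW → ℝ) :
    ∑ i, v i * Mesh.integral (fun K x => g K x * Mesh.evalW (S.basisW i) K x)
      = Mesh.integral fun K x => g K x * Mesh.evalW (S.fn v) K x := by
  rw [← Mesh.integral_sum (g := fun i K x => g K x * Mesh.evalW (S.basisW i) K x) _ _
    fun i _ K => K.integrableOn_of_continuous ((hg K).mul (Mesh.continuous_evalW _ K))]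
  refine Mesh.integral_congr fun K x _ => ?_
  rw [fn, Mesh.evalW_sum, Finset.mul_sum]
  exact Finset.sum_congr rfl fun i _ => by ring

theorem dotProduct_vecU [Fintype ιW] (c : Species) (v w : ιW → ℝ) :
    v ⬝ᵥ S.vecU c w = Mesh.integral fun K x =>
      S.rates.u c (Mesh.evalW (S.fn w) K x) * Mesh.evalW (S.fn v) K x :=
  sum_mul_integral_mul_basisW
    (fun K => (Rates.continuous_u c).comp (Mesh.continuous_evalW (S.fn w) K)) v

theorem dotProduct_vecF [Fintype ιW] (c : Species) (v wp wq : ιW → ℝ) :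
    v ⬝ᵥ S.vecF c wp wq = Mesh.integral fun K x =>
      S.rates.f c (S.rates.u .p (Mesh.evalW (S.fn wp) K x))
        (S.rates.u .q (Mesh.evalW (S.fn wq) K x)) * Mesh.evalW (S.fn v) K x :=
  sum_mul_integral_mul_basisW (fun K => continuous_reaction_comp continuous_const continuous_const
    continuous_id c K) v

theorem dotProduct_matA_mulVec [Fintype ιW] (w : ιW → ℝ) :
    w ⬝ᵥ (S.matA *ᵥ w) = S.ldg (S.fn w) (S.fn w) := by
  simp only [dotProduct, mulVec, matA, of_apply, fn, map_sum, map_smul, LinearMap.sum_apply,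
    LinearMap.smul_apply, smul_eq_mul, Finset.mul_sum]
  exact Finset.sum_congr rfl fun i _ => Finset.sum_congr rfl fun j _ => by ring

/-- The inner product of the penalty term controls the size of the coefficient vector. -/
theorem exists_mul_sq_norm_le_matA [Fintype ιW] (hpos : ∀ v, v ≠ 0 → 0 < S.ldg v v) :
    ∃ α : ℝ, 0 < α ∧ ∀ w : ιW → ℝ, α * ‖w‖ ^ 2 ≤ w ⬝ᵥ (S.matA *ᵥ w) := by
  have hpos' : ∀ w : ιW → ℝ, w ≠ 0 → 0 < w ⬝ᵥ (S.matA *ᵥ w) := fun w hw => by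
    rw [dotProduct_matA_mulVec]
    refine hpos _ fun h0 => hw ?_
    exact funext (Fintype.linearIndependent_iff.1 S.basisW.linearIndependent w h0)
  have hcont : Continuous fun w : ιW → ℝ => w ⬝ᵥ (S.matA *ᵥ w) :=
    continuous_id.dotProduct (continuous_const.matrix_mulVec continuous_id)
  obtain ⟨α, hα, h⟩ : ∃ α : ℝ, 0 < α ∧ ∀ w ∈ Metric.sphere (0 : ιW → ℝ) 1,
      α ≤ w ⬝ᵥ (S.matA *ᵥ w) := by
    rcases (Metric.sphere (0 : ιW → ℝ) 1).eq_empty_or_nonempty with he | hne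
    · exact ⟨1, one_pos, by simp [he]⟩
    obtain ⟨w, hw, hmin⟩ := (isCompact_sphere (0 : ιW → ℝ) 1).exists_isMinOn hne hcont.continuousOn
    exact ⟨_, hpos' w (ne_zero_of_mem_unit_sphere ⟨w, hw⟩), fun v hv => hmin hv⟩
  refine ⟨α, hα, fun w => ?_⟩
  rcases eq_or_ne w 0 with rfl | hw
  · simp
  have hw' : 0 < ‖w‖ := norm_pos_iff.2 hw
  have h1 := h (‖w‖⁻¹ • w) (by
    rw [mem_sphere_zero_iff_norm, norm_smul, norm_inv, norm_norm, inv_mul_cancel₀ hw'.ne'])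
  rw [mulVec_smul, dotProduct_smul, smul_dotProduct, smul_eq_mul, smul_eq_mul, ← mul_assoc,
    ← mul_inv, ← sq, inv_mul_eq_div, le_div_iff₀ (by positivity)] at h1
  exact h1

end Scheme

end ConformationalLDG

namespace ConformationalLDG

/-! ### Pointwise bounds of the reaction terms -/

namespace Rates

variable {r : Rates}

theorem neg_exp_mul_le_one (y : ℝ) : -(Real.exp y * y) ≤ 1 := by
  have h := Real.add_one_le_exp (-y)
  have h1 : Real.exp y * Real.exp (-y) = 1 := by rw [← Real.exp_add]; simp
  nlinarith [Real.exp_pos y]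

theorem neg_le_u_mul_self (hP : 0 < r.equiP) (hQ : 0 < r.equiQ) (y : ℝ) :
    -r.equiP ≤ r.u .p y * y ∧ -r.equiQ ≤ r.u .q y * y := by
  have h := neg_exp_mul_le_one y
  have he := Real.exp_pos y
  constructor
  · have h1 : -1 ≤ Real.exp y / (1 + Real.exp y) * y := by
      rw [div_mul_eq_mul_div, le_div_iff₀ (by positivity)]
      linarith
    simp only [u]
    nlinarith
  · simp only [u]
    nlinarith

/-- The sum of the reaction terms is bounded above: what `p` loses to `q` is gained by `q`. -/
theorem f_add_f_le (hlP : 0 ≤ r.lamP) (hlQ : 0 ≤ r.lamQ) {x y : ℝ} (hx : 0 ≤ x) (hy : 0 ≤ y) :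
    r.f .p x y + r.f .q x y ≤ r.kappa := by
  simp only [f]
  nlinarith [mul_nonneg hlP hx, mul_nonneg hlQ hy]

/-- The reaction terms, tested with the entropy variables `y` and `z`. The only superlinear term
that is left is the one from the growth of `q` at the expense of `p`. -/
theorem f_mul_add_f_mul_le (hlP : 0 < r.lamP) (hlQ : 0 ≤ r.lamQ) (hmu : 0 ≤ r.mu)
    (hP : 0 < r.equiP) (hQ : 0 < r.equiQ) (y z : ℝ) :
    r.f .p (r.u .p y) (r.u .q z) * y + r.f .q (r.u .p y) (r.u .q z) * z
      ≤ r.kappa * |y| + r.lamQ * r.equiQ + r.mu * r.equiP * (r.u .q z * (1 + max z 0)) := by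
  set p := r.u .p y
  set q := r.u .q z
  have hp : 0 < p := u_pos hP hQ .p y
  have hq : 0 < q := u_pos hP hQ .q z
  have hpE : p < r.equiP := u_p_lt hP y
  have hkE : r.lamP * r.equiP = r.kappa := by
    rw [equiP]; field_simp
  have h1 : (r.kappa - r.lamP * p) * y ≤ r.kappa * |y| := by
    have : 0 ≤ r.kappa - r.lamP * p := by rw [← hkE]; nlinarith
    calc (r.kappa - r.lamP * p) * y ≤ (r.kappa - r.lamP * p) * |y| :=
          mul_le_mul_of_nonneg_left (le_abs_self y) this
      _ ≤ r.kappa * |y| := mul_le_mul_of_nonneg_right (by nlinarith) (abs_nonneg y)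
  have h2 : r.mu * q * (-(p * y)) ≤ r.mu * q * r.equiP :=
    mul_le_mul_of_nonneg_left (by linarith [(neg_le_u_mul_self hP hQ y).1]) (by positivity)
  have h3 : r.lamQ * (-(q * z)) ≤ r.lamQ * r.equiQ :=
    mul_le_mul_of_nonneg_left (by linarith [(neg_le_u_mul_self hP hQ z).2]) hlQ
  have h4 : r.mu * q * (p * z) ≤ r.mu * q * (r.equiP * max z 0) := by
    refine mul_le_mul_of_nonneg_left ?_ (by positivity)
    exact (mul_le_mul_of_nonneg_left (le_max_left z 0) hp.le).trans
      (mul_le_mul_of_nonneg_right hpE.le (le_max_right z 0))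
  simp only [f]
  linarith

theorem exists_max_le_mul_u_q_add (hQ : 0 < r.equiQ) {η : ℝ} (hη : 0 < η) :
    ∃ C, 0 ≤ C ∧ ∀ y, max y 0 ≤ η * r.u .q y + C := by
  refine ⟨|Real.log (η * r.equiQ)|, abs_nonneg _, fun y => ?_⟩
  have hm : 0 < η * r.equiQ := mul_pos hη hQ
  have h1 := Real.add_one_le_exp (Real.log (η * r.equiQ) + y)
  rw [Real.exp_add, Real.exp_log hm] at h1
  have h2 := neg_abs_le (Real.log (η * r.equiQ))
  have he := Real.exp_pos y
  simp only [u]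
  refine max_le (by linarith) (by positivity)

end Rates

namespace Scheme

variable {d l : ℕ} {ιW ιR : Type*} {S : Scheme d l ιW ιR} [Fintype ιW]

/-! ### Growth of broken polynomials -/

theorem evalW_fn_smul (a : ℝ) (w : ιW → ℝ) (K : S.T.Elem) (x : E d) :
    Mesh.evalW (S.fn (a • w)) K x = a * Mesh.evalW (S.fn w) K x := by
  simp only [fn, Mesh.evalW_sum, Finset.mul_sum, Pi.smul_apply, smul_eq_mul]
  exact Finset.sum_congr rfl fun i _ => by ring

variable (S) in
theorem exists_abs_evalW_le : ∃ C, 0 ≤ C ∧ ∀ (w : ιW → ℝ) (K : S.T.Elem), ∀ x ∈ K.carrier,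
    |Mesh.evalW (S.fn w) K x| ≤ C * ‖w‖ := by
  have h : ∀ (K : S.T.Elem) (i : ιW), ∃ C, ∀ x ∈ K.carrier, ‖Mesh.evalW (S.basisW i) K x‖ ≤ C :=
    fun K i => K.isCompact_carrier.exists_bound_of_continuousOn
      (Mesh.continuous_evalW _ K).continuousOn
  choose C hC using h
  have hC0 : ∀ K i, 0 ≤ |C K i| := fun K i => abs_nonneg _
  refine ⟨∑ K, ∑ i, |C K i|, by positivity, fun w K x hx => ?_⟩
  rw [fn, Mesh.evalW_sum]
  calc |∑ i, w i * Mesh.evalW (S.basisW i) K x|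
      ≤ ∑ i, |w i * Mesh.evalW (S.basisW i) K x| := Finset.abs_sum_le_sum_abs _ _
    _ ≤ ∑ i, |C K i| * ‖w‖ := Finset.sum_le_sum fun i _ => by
        rw [abs_mul, mul_comm]
        exact mul_le_mul ((hC K i x hx).trans (le_abs_self _)) (norm_le_pi_norm w i)
          (abs_nonneg _) (abs_nonneg _)
    _ = (∑ i, |C K i|) * ‖w‖ := (Finset.sum_mul _ _ _).symm
    _ ≤ _ := mul_le_mul_of_nonneg_right (Finset.single_le_sum (f := fun K => ∑ i, |C K i|)
        (fun K _ => by positivity) (Finset.mem_univ K)) (norm_nonneg _)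

theorem continuous_max_evalW (w : ιW → ℝ) (K : S.T.Elem) :
    Continuous fun x => max (Mesh.evalW (S.fn w) K x) 0 :=
  (Mesh.continuous_evalW _ K).max continuous_const

/-- Up to a small multiple of the norm, the maximum of a broken polynomial is controlled by the
integral of its positive part: on the compact set of the pairs of a normalized polynomial and a
point where its value is at least `δ`, this integral is bounded below. -/
theorem exists_evalW_le_add_integral_max {δ : ℝ} (hδ : 0 < δ) :
    ∃ C, 0 ≤ C ∧ ∀ (w : ιW → ℝ) (K : S.T.Elem), ∀ x ∈ K.carrier, Mesh.evalW (S.fn w) K x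
      ≤ δ * ‖w‖ + C * Mesh.integral fun K x => max (Mesh.evalW (S.fn w) K x) 0 := by
  obtain ⟨C₀, hC₀, hb⟩ := exists_abs_evalW_le S
  have key : ∀ K : S.T.Elem, ∃ C, 0 ≤ C ∧ ∀ w : ιW → ℝ, ∀ x ∈ K.carrier, Mesh.evalW (S.fn w) K x
      ≤ δ * ‖w‖ + C * ∫ x in K.carrier, max (Mesh.evalW (S.fn w) K x) 0 := by
    intro K
    set Z : Set ((ιW → ℝ) × E d) := (Metric.sphere 0 1 ×ˢ K.carrier) ∩
      {z | δ ≤ Mesh.evalW (S.fn z.1) K z.2} with hZ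
    have hZc : IsCompact Z := ((isCompact_sphere _ _).prod K.isCompact_carrier).inter_right
      (isClosed_le continuous_const (continuous_evalW_fn K))
    have hI : Continuous fun w : ιW → ℝ => ∫ x in K.carrier, max (Mesh.evalW (S.fn w) K x) 0 := by
      have := K.continuous_setIntegral_mul
        (h := fun (w : ιW → ℝ) x => max (Mesh.evalW (S.fn w) K x) 0)
        (K.integrableOn_of_continuous (continuous_const (y := (1 : ℝ))))
        ((continuous_evalW_fn K).max continuous_const)
      simpa using this
    obtain ⟨m, hm, hmZ⟩ : ∃ m : ℝ, 0 < m ∧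
        ∀ z ∈ Z, m ≤ ∫ x in K.carrier, max (Mesh.evalW (S.fn z.1) K x) 0 := by
      rcases Z.eq_empty_or_nonempty with he | hne
      · exact ⟨1, one_pos, by simp [he]⟩
      obtain ⟨z, hz, hmin⟩ := hZc.exists_isMinOn hne (hI.comp continuous_fst).continuousOn
      refine ⟨_, ?_, fun z' hz' => hmin hz'⟩
      exact Mesh.Elem.setIntegral_pos (continuous_max_evalW z.1 K) (fun _ _ => le_max_right _ _)
        hz.1.2 (lt_max_of_lt_left (hδ.trans_le hz.2))
    refine ⟨C₀ / m, by positivity, fun w x hx => ?_⟩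
    have hint : 0 ≤ ∫ x in K.carrier, max (Mesh.evalW (S.fn w) K x) 0 :=
      setIntegral_nonneg K.measurableSet_carrier fun _ _ => le_max_right _ _
    rcases eq_or_ne w 0 with rfl | hw
    · have := hb 0 K x hx
      rw [norm_zero, mul_zero] at this ⊢
      have := (le_abs_self _).trans this
      have h0 : 0 ≤ C₀ / m * ∫ x in K.carrier, max (Mesh.evalW (S.fn 0) K x) 0 :=
        mul_nonneg (by positivity) hint
      linarith
    have hn : 0 < ‖w‖ := norm_pos_iff.2 hw
    by_cases hle : Mesh.evalW (S.fn w) K x ≤ δ * ‖w‖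
    · have : 0 ≤ C₀ / m * ∫ x in K.carrier, max (Mesh.evalW (S.fn w) K x) 0 := by positivity
      linarith
    · push Not at hle
      have hz : (‖w‖⁻¹ • w, x) ∈ Z := by
        refine ⟨⟨?_, hx⟩, ?_⟩
        · rw [mem_sphere_zero_iff_norm, norm_smul, norm_inv, norm_norm, inv_mul_cancel₀ hn.ne']
        · simp only [Set.mem_ofPred_eq, evalW_fn_smul]
          rw [inv_mul_eq_div, le_div_iff₀ hn]
          exact hle.le
      have h1 := hmZ _ hz
      have h2 : ∀ y, max (Mesh.evalW (S.fn (‖w‖⁻¹ • w)) K y) 0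
          = ‖w‖⁻¹ * max (Mesh.evalW (S.fn w) K y) 0 := fun y => by
        rw [evalW_fn_smul, mul_max_of_nonneg _ _ (inv_nonneg.2 hn.le), mul_zero]
      simp only [h2] at h1
      rw [integral_const_mul, inv_mul_eq_div, le_div_iff₀ hn] at h1
      have h3 := (le_abs_self _).trans (hb w K x hx)
      have h4 : C₀ * ‖w‖ ≤ C₀ / m * ∫ x in K.carrier, max (Mesh.evalW (S.fn w) K x) 0 := by
        rw [div_mul_eq_mul_div, le_div_iff₀ hm]
        nlinarith
      have : 0 ≤ δ * ‖w‖ := by positivity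
      linarith
  choose C hC hCb using key
  refine ⟨∑ K, C K, Finset.sum_nonneg fun K _ => hC K, fun w K x hx => ?_⟩
  have hnn : ∀ K : S.T.Elem, 0 ≤ ∫ x in K.carrier, max (Mesh.evalW (S.fn w) K x) 0 := fun K =>
    setIntegral_nonneg K.measurableSet_carrier fun _ _ => le_max_right _ _
  refine (hCb K w x hx).trans (add_le_add_right ?_ _)
  exact mul_le_mul (Finset.single_le_sum (fun K _ => hC K) (Finset.mem_univ K))
    (Finset.single_le_sum (f := fun K : S.T.Elem => ∫ x in K.carrier,
      max (Mesh.evalW (S.fn w) K x) 0) (fun K _ => hnn K) (Finset.mem_univ K)) (hnn K)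
    (Finset.sum_nonneg fun K _ => hC K)

/-- If the integral of `u_q(w)` grows at most linearly in the norm of `w`, the positive part of `w`
grows sublinearly. -/
theorem exists_max_evalW_le_of_integral_u_q_le (hQ : 0 < S.rates.equiQ) {C₁ : ℝ} (hC₁ : 0 ≤ C₁)
    {δ : ℝ} (hδ : 0 < δ) : ∃ C, 0 ≤ C ∧ ∀ (w : ιW → ℝ) (R : ℝ), ‖w‖ ≤ R →
      (Mesh.integral fun K x => S.rates.u .q (Mesh.evalW (S.fn w) K x)) ≤ C₁ * (1 + R) →
      ∀ (K : S.T.Elem), ∀ x ∈ K.carrier, max (Mesh.evalW (S.fn w) K x) 0 ≤ δ * R + C := by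
  obtain ⟨Cδ, hCδ, hmax⟩ := exists_evalW_le_add_integral_max (S := S) (half_pos hδ)
  -- `η` is such that `Cδ C₁ η ≤ δ / 2`
  set η := δ / 2 / ((Cδ + 1) * (C₁ + 1)) with hη
  have hη0 : 0 < η := by positivity
  obtain ⟨Cη, hCη, hη1⟩ := Rates.exists_max_le_mul_u_q_add hQ hη0
  set V : ℝ := Mesh.integral fun (_ : S.T.Elem) _ => (1 : ℝ) with hV
  have hV0 : 0 ≤ V := Finset.sum_nonneg fun K _ => setIntegral_nonneg K.measurableSet_carrier
    fun _ _ => zero_le_one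
  refine ⟨δ / 2 + Cδ * (Cη * V), by positivity, fun w R hwR hq K x hx => ?_⟩
  have hR : 0 ≤ R := (norm_nonneg w).trans hwR
  have hqc : ∀ K : S.T.Elem, Continuous fun x => S.rates.u .q (Mesh.evalW (S.fn w) K x) := fun K =>
    (Rates.continuous_u .q).comp (Mesh.continuous_evalW _ K)
  have h1 : (Mesh.integral fun K x => max (Mesh.evalW (S.fn w) K x) 0)
      ≤ η * (C₁ * (1 + R)) + Cη * V := by
    calc _ ≤ Mesh.integral fun K x => η * S.rates.u .q (Mesh.evalW (S.fn w) K x) + Cη * 1 :=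
          Mesh.integral_mono (fun K => K.integrableOn_of_continuous (continuous_max_evalW w K))
            (fun K => K.integrableOn_of_continuous
              ((continuous_const.mul (hqc K)).add continuous_const))
            fun K x _ => by rw [mul_one]; exact hη1 _
      _ = η * (Mesh.integral fun K x => S.rates.u .q (Mesh.evalW (S.fn w) K x)) + Cη * V := by
          rw [Mesh.integral_add (f := fun K x => η * S.rates.u .q (Mesh.evalW (S.fn w) K x))
            (fun K => K.integrableOn_of_continuous (continuous_const.mul (hqc K)))
            (fun K => K.integrableOn_of_continuous continuous_const),
            Mesh.integral_const_mul, Mesh.integral_const_mul]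
      _ ≤ _ := by gcongr
  have h2 : Cδ * (η * (C₁ * (1 + R))) ≤ δ / 2 * (1 + R) := by
    have h3 : Cδ * C₁ * η ≤ δ / 2 := by
      rw [hη, mul_div_assoc', div_le_iff₀ (by positivity)]
      have : Cδ * C₁ ≤ (Cδ + 1) * (C₁ + 1) := by nlinarith
      nlinarith
    nlinarith
  have h4 := hmax w K x hx
  have h5 := mul_le_mul_of_nonneg_left h1 hCδ
  have h6 : δ / 2 * ‖w‖ ≤ δ / 2 * R := mul_le_mul_of_nonneg_left hwR (by positivity)
  refine max_le ?_ (by positivity)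
  nlinarith

end Scheme

end ConformationalLDG

namespace ConformationalLDG

theorem abs_dotProduct_le_sum_abs_mul_norm {n : Type*} [Fintype n] (v w : n → ℝ) :
    |v ⬝ᵥ w| ≤ (∑ i, |v i|) * ‖w‖ := by
  rw [Finset.sum_mul]
  refine (Finset.abs_sum_le_sum_abs _ _).trans (Finset.sum_le_sum fun i _ => ?_)
  rw [abs_mul]
  exact mul_le_mul_of_nonneg_left (norm_le_pi_norm w i) (abs_nonneg _)

theorem dotProduct_self_le_card_mul_sq_norm {n : Type*} [Fintype n] (w : n → ℝ) :
    w ⬝ᵥ w ≤ Fintype.card n * ‖w‖ ^ 2 := by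
  refine (Finset.sum_le_card_nsmul _ _ (‖w‖ ^ 2) fun i _ => ?_).trans_eq (by simp)
  rw [← sq, ← sq_abs]
  exact pow_le_pow_left₀ (abs_nonneg _) (norm_le_pi_norm w i) 2

/-- In the quadratic inequality from the test with the solution, the quadratic part of the
right-hand side has the coefficient `m C₁ δ`, small compared with `α`. -/
theorem le_max_of_quadratic_le {α A B m δ C₁ C₃ R : ℝ} (hα : 0 < α) (hB : 0 ≤ B) (hm : 0 ≤ m)
    (hC₁ : 0 ≤ C₁) (hC₃ : 0 ≤ C₃) (hA : 0 ≤ A) (hδ : m * C₁ * δ ≤ α / 8)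
    (h : α / 2 * R ^ 2 ≤ A * R + B + m * (1 + (δ * R + C₃)) * (C₁ * (1 + R))) :
    R ≤ max 1 (8 * (A + B + m * ((1 + C₃) * C₁)) / α) := by
  rcases le_total R 1 with h1 | h1
  · exact h1.trans (le_max_left _ _)
  refine le_trans ?_ (le_max_right _ _)
  rw [le_div_iff₀ hα]
  have hδR : m * (δ * R) * (C₁ * (1 + R)) ≤ α / 8 * (2 * R ^ 2) := by
    calc m * (δ * R) * (C₁ * (1 + R)) = m * C₁ * δ * (R * (1 + R)) := by ring
      _ ≤ α / 8 * (R * (1 + R)) := mul_le_mul_of_nonneg_right hδ (by positivity)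
      _ ≤ _ := mul_le_mul_of_nonneg_left (by nlinarith) (by positivity)
  have e1 : B ≤ B * R := le_mul_of_one_le_right hB h1
  have e2 : m * ((1 + C₃) * C₁) ≤ m * ((1 + C₃) * C₁) * R :=
    le_mul_of_one_le_right (by positivity) h1
  have e3 : 0 ≤ A * R := by positivity
  have e4 : 0 ≤ B * R := by positivity
  have e5 : m * (1 + (δ * R + C₃)) * (C₁ * (1 + R)) = m * (δ * R) * (C₁ * (1 + R))
      + m * ((1 + C₃) * C₁) + m * ((1 + C₃) * C₁) * R := by ring
  rw [e5] at h
  refine le_of_mul_le_mul_right ?_ (zero_lt_one.trans_le h1)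
  linarith

namespace Scheme

variable {d l : ℕ} {ιW ιR : Type*} {S : Scheme d l ιW ιR}

/-! ### A priori bounds and existence -/

theorem integral_one_nonneg : 0 ≤ Mesh.integral fun (_ : S.T.Elem) _ => (1 : ℝ) :=
  Finset.sum_nonneg fun K _ => setIntegral_nonneg K.measurableSet_carrier fun _ _ => zero_le_one

theorem continuous_u_evalW [Fintype ιW] (c : Species) (w : ιW → ℝ) (K : S.T.Elem) :
    Continuous fun x => S.rates.u c (Mesh.evalW (S.fn w) K x) :=
  (Rates.continuous_u c).comp (Mesh.continuous_evalW _ K)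

theorem dotProduct_vecF_add_dotProduct_vecF_le [Fintype ιW] (hkap : 0 ≤ S.rates.kappa)
    (hlP : 0 < S.rates.lamP) (hlQ : 0 ≤ S.rates.lamQ) (hmu : 0 ≤ S.rates.mu)
    (hP : 0 < S.rates.equiP) (hQ : 0 < S.rates.equiQ) (wp wq : ιW → ℝ) {Y Z : ℝ}
    (hY : ∀ (K : S.T.Elem), ∀ x ∈ K.carrier, |Mesh.evalW (S.fn wp) K x| ≤ Y)
    (hZ : ∀ (K : S.T.Elem), ∀ x ∈ K.carrier, max (Mesh.evalW (S.fn wq) K x) 0 ≤ Z) :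
    wp ⬝ᵥ S.vecF .p wp wq + wq ⬝ᵥ S.vecF .q wp wq
      ≤ (S.rates.kappa * Y + S.rates.lamQ * S.rates.equiQ)
          * (Mesh.integral fun (_ : S.T.Elem) _ => (1 : ℝ))
        + S.rates.mu * S.rates.equiP * (1 + Z)
          * Mesh.integral fun K x => S.rates.u .q (Mesh.evalW (S.fn wq) K x) := by
  have hcf : ∀ a w (K : S.T.Elem), Continuous fun x =>
      S.rates.f a (S.rates.u .p (Mesh.evalW (S.fn wp) K x))
        (S.rates.u .q (Mesh.evalW (S.fn wq) K x)) * Mesh.evalW (S.fn w) K x := fun a w K =>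
    (continuous_reaction_comp continuous_const continuous_const continuous_id a K).mul
      (Mesh.continuous_evalW _ K)
  have hcu := continuous_u_evalW (S := S) .q wq
  rw [dotProduct_vecF, dotProduct_vecF, ← Mesh.integral_const_mul, ← Mesh.integral_const_mul,
    ← Mesh.integral_add (fun K => K.integrableOn_of_continuous (hcf .p wp K))
      (fun K => K.integrableOn_of_continuous (hcf .q wq K)),
    ← Mesh.integral_add (g := fun K x => S.rates.mu * S.rates.equiP * (1 + Z)
        * S.rates.u .q (Mesh.evalW (S.fn wq) K x))
      (fun K => K.integrableOn_of_continuous continuous_const)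
      (fun K => K.integrableOn_of_continuous (continuous_const.mul (hcu K)))]
  refine Mesh.integral_mono
    (fun K => K.integrableOn_of_continuous ((hcf .p wp K).add (hcf .q wq K)))
    (fun K => K.integrableOn_of_continuous
      (continuous_const.add (continuous_const.mul (hcu K)))) fun K x hx => ?_
  refine (Rates.f_mul_add_f_mul_le hlP hlQ hmu hP hQ _ _).trans ?_
  have h1 := mul_le_mul_of_nonneg_left (hY K x hx) hkap
  have h2 := hZ K x hx
  have h3 := (Rates.u_pos hP hQ .q (Mesh.evalW (S.fn wq) K x)).le
  have h4 : S.rates.mu * S.rates.equiP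
        * (S.rates.u .q (Mesh.evalW (S.fn wq) K x) * (1 + max (Mesh.evalW (S.fn wq) K x) 0))
      ≤ S.rates.mu * S.rates.equiP * (S.rates.u .q (Mesh.evalW (S.fn wq) K x) * (1 + Z)) := by
    gcongr
  linarith

variable [Fintype ιW] [Fintype ιR] [DecidableEq ιR]

variable (S) in
/-- The left-hand side of the second equation of the system after elimination of `Σ_⋆`, with `k` in
place of the reciprocal of the time step. -/
noncomputable def reducedOp (k : ℝ) (a : Species) (w : ιW → ℝ) : ιW → ℝ :=
  S.eps • (S.matA *ᵥ w) + k • S.vecU a w + S.diffusion a w + S.matJ *ᵥ w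

theorem continuous_reducedOp (hP : 0 < S.rates.equiP) (hQ : 0 < S.rates.equiQ) {c : ℝ} (hc : 0 < c)
    (hD : IsDiffusionTensor (volume.restrict S.T.domain) S.D c) (k : ℝ) (a : Species) :
    Continuous (S.reducedOp k a) := by
  have h1 : Continuous fun w : ιW → ℝ => S.matA *ᵥ w :=
    continuous_const.matrix_mulVec continuous_id
  have h2 : Continuous fun w : ιW → ℝ => S.matJ *ᵥ w :=
    continuous_const.matrix_mulVec continuous_id
  exact (((h1.const_smul S.eps).add ((continuous_vecU a).const_smul k)).add
    (continuous_diffusion hP hQ hc hD a)).add h2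

/-- The reduced operator is coercive, thanks to the penalty term. -/
theorem exists_mul_sq_norm_sub_le_reducedOp (hP : 0 < S.rates.equiP) (hQ : 0 < S.rates.equiQ)
    {c : ℝ} (hc : 0 < c) (hD : IsDiffusionTensor (volume.restrict S.T.domain) S.D c)
    (htrD : ∀ (F : S.T.InnerFacet) (K : S.T.Elem), F.1 ⊆ K.1 →
      IsDiffusionTensor F.surface (S.trD K) c)
    (heps : 0 < S.eps) (heta0 : 0 ≤ S.eta0) (hpos : ∀ v, v ≠ 0 → 0 < S.ldg v v) {k : ℝ}
    (hk : 0 ≤ k) : ∃ α C : ℝ, 0 < α ∧ 0 ≤ C ∧ ∀ (a : Species) (w : ιW → ℝ),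
      α * ‖w‖ ^ 2 - C ≤ w ⬝ᵥ S.reducedOp k a w := by
  obtain ⟨α, hα, hA⟩ := exists_mul_sq_norm_le_matA (S := S) hpos
  have hV := integral_one_nonneg (S := S)
  set V : ℝ := Mesh.integral fun (_ : S.T.Elem) _ => (1 : ℝ)
  refine ⟨S.eps * α, k * ((S.rates.equiP + S.rates.equiQ) * V), by positivity, by positivity,
    fun a w => ?_⟩
  have hU : -((S.rates.equiP + S.rates.equiQ) * V) ≤ w ⬝ᵥ S.vecU a w := by
    rw [dotProduct_vecU, ← neg_mul, ← Mesh.integral_const_mul]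
    refine Mesh.integral_mono (fun K => K.integrableOn_of_continuous continuous_const)
      (fun K => K.integrableOn_of_continuous
        ((continuous_u_evalW a w K).mul (Mesh.continuous_evalW _ K))) fun K x _ => ?_
    have h := Rates.neg_le_u_mul_self hP hQ (Mesh.evalW (S.fn w) K x)
    cases a
    · linarith [h.1]
    · linarith [h.2]
  have h1 := mul_le_mul_of_nonneg_left hU hk
  have h2 := mul_le_mul_of_nonneg_left (hA w) heps.le
  have h3 := dotProduct_diffusion_self_nonneg hP hQ hc hD a w
  have h4 := dotProduct_matJ_mulVec_nonneg heta0 hc htrD w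
  simp only [reducedOp, dotProduct_add, dotProduct_smul, smul_eq_mul]
  linarith

/-- Testing both equations with the constant function `1`, for which the facet and diffusive terms
vanish, bounds the mass of `q` linearly in the size of the solution. -/
theorem exists_integral_u_q_le (hlP : 0 ≤ S.rates.lamP) (hlQ : 0 ≤ S.rates.lamQ)
    (hkap : 0 ≤ S.rates.kappa)
    (hP : 0 < S.rates.equiP) (hQ : 0 < S.rates.equiQ)
    {c : ℝ} (hc : 0 < c)
    (htrD : ∀ (F : S.T.InnerFacet) (K : S.T.Elem), F.1 ⊆ K.1 →
      IsDiffusionTensor F.surface (S.trD K) c) {k : ℝ} (hk : 0 < k) (b : Species → ιW → ℝ) :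
    ∃ C, 0 ≤ C ∧ ∀ (θ : ℝ) (wp wq : ιW → ℝ), 0 ≤ θ → θ ≤ 1 →
      S.reducedOp k .p wp = θ • (S.vecF .p wp wq + b .p) →
      S.reducedOp k .q wq = θ • (S.vecF .q wp wq + b .q) →
      (Mesh.integral fun K x => S.rates.u .q (Mesh.evalW (S.fn wq) K x))
        ≤ C * (1 + (‖wp‖ + ‖wq‖)) := by
  have hV := integral_one_nonneg (S := S)
  set V : ℝ := Mesh.integral fun (_ : S.T.Elem) _ => (1 : ℝ) with hVdef
  set a : ℝ := ∑ i, |(S.one ᵥ* S.matA) i| with ha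
  have ha0 : 0 ≤ a := by positivity
  set β : ℝ := |S.one ⬝ᵥ b .p| + |S.one ⬝ᵥ b .q| with hβ
  have hβ0 : 0 ≤ β := by positivity
  refine ⟨k⁻¹ * (|S.eps| * a + S.rates.kappa * V + β), by positivity, ?_⟩
  intro θ wp wq hθ0 hθ1 hp hq
  have hA : ∀ w : ιW → ℝ, |S.one ⬝ᵥ (S.matA *ᵥ w)| ≤ a * ‖w‖ := fun w => by
    rw [dotProduct_mulVec]
    exact abs_dotProduct_le_sum_abs_mul_norm _ _
  have hone : ∀ c w, S.one ⬝ᵥ S.vecU c w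
      = Mesh.integral fun K x => S.rates.u c (Mesh.evalW (S.fn w) K x) := fun c w => by
    rw [dotProduct_vecU, fn_one]
    simp only [Mesh.evalW_oneW, mul_one]
  have hup : 0 ≤ S.one ⬝ᵥ S.vecU .p wp := by
    rw [hone]
    exact Finset.sum_nonneg fun K _ => setIntegral_nonneg K.measurableSet_carrier
      fun x _ => (Rates.u_pos hP hQ .p _).le
  have hF : S.one ⬝ᵥ S.vecF .p wp wq + S.one ⬝ᵥ S.vecF .q wp wq ≤ S.rates.kappa * V := by
    have hcont : ∀ a (K : S.T.Elem), Continuous fun x =>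
        S.rates.f a (S.rates.u .p (Mesh.evalW (S.fn wp) K x))
          (S.rates.u .q (Mesh.evalW (S.fn wq) K x)) * Mesh.evalW (Mesh.oneW S.T l) K x :=
      fun a K => (continuous_reaction_comp continuous_const continuous_const continuous_id a K).mul
        (Mesh.continuous_evalW _ K)
    rw [dotProduct_vecF, dotProduct_vecF, fn_one, hVdef, ← Mesh.integral_const_mul,
      ← Mesh.integral_add (fun K => K.integrableOn_of_continuous (hcont .p K))
        (fun K => K.integrableOn_of_continuous (hcont .q K))]
    refine Mesh.integral_mono
      (fun K => K.integrableOn_of_continuous ((hcont .p K).add (hcont .q K)))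
      (fun K => K.integrableOn_of_continuous continuous_const) fun K x _ => ?_
    rw [Mesh.evalW_oneW, mul_one, mul_one, mul_one]
    exact Rates.f_add_f_le hlP hlQ (Rates.u_pos hP hQ .p _).le (Rates.u_pos hP hQ .q _).le
  have hp1 := congrArg (fun v => S.one ⬝ᵥ v) hp
  have hq1 := congrArg (fun v => S.one ⬝ᵥ v) hq
  simp only [reducedOp, dotProduct_add, dotProduct_smul, smul_eq_mul,
    one_dotProduct_matJ_mulVec hc htrD, one_dotProduct_diffusion, add_zero] at hp1 hq1
  have hR : θ * (S.one ⬝ᵥ S.vecF .p wp wq + S.one ⬝ᵥ b .p)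
      + θ * (S.one ⬝ᵥ S.vecF .q wp wq + S.one ⬝ᵥ b .q) ≤ S.rates.kappa * V + β := by
    have h1 : S.one ⬝ᵥ b .p + S.one ⬝ᵥ b .q ≤ β :=
      add_le_add (le_abs_self _) (le_abs_self _)
    have h2 : 0 ≤ S.rates.kappa * V + β := by positivity
    calc _ = θ * ((S.one ⬝ᵥ S.vecF .p wp wq + S.one ⬝ᵥ S.vecF .q wp wq)
          + (S.one ⬝ᵥ b .p + S.one ⬝ᵥ b .q)) := by ring
      _ ≤ θ * (S.rates.kappa * V + β) := mul_le_mul_of_nonneg_left (add_le_add hF h1) hθ0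
      _ ≤ _ := mul_le_of_le_one_left h2 hθ1
  have hE : ∀ w : ιW → ℝ, -(|S.eps| * a * ‖w‖) ≤ S.eps * (S.one ⬝ᵥ (S.matA *ᵥ w)) := fun w => by
    have h1 := neg_abs_le (S.eps * (S.one ⬝ᵥ (S.matA *ᵥ w)))
    rw [abs_mul] at h1
    have h2 := mul_le_mul_of_nonneg_left (hA w) (abs_nonneg S.eps)
    linarith
  have hmain : k * (S.one ⬝ᵥ S.vecU .q wq)
      ≤ (|S.eps| * a + S.rates.kappa * V + β) * (1 + (‖wp‖ + ‖wq‖)) := by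
    have h1 := hE wp
    have h2 := hE wq
    have h3 := mul_nonneg hk.le hup
    have h4 : 0 ≤ (S.rates.kappa * V + β) * (‖wp‖ + ‖wq‖) := by positivity
    have h5 : 0 ≤ |S.eps| * a := by positivity
    nlinarith
  rw [hone] at hmain
  rw [mul_assoc, inv_mul_eq_div, le_div_iff₀ hk, mul_comm]
  exact hmain

/-- The a priori bound for the system with right-hand side scaled by `θ ∈ [0, 1]`. The test with the
solution leaves the superlinear term `∫ q (1 + w_q⁺)`, in which `∫ q` grows at most linearly and
`w_q⁺` sublinearly, so that the penalty term dominates. -/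
theorem exists_norm_add_norm_le (hkap : 0 < S.rates.kappa) (hlP : 0 < S.rates.lamP)
    (hlQ : 0 ≤ S.rates.lamQ) (hmu : 0 ≤ S.rates.mu)
    (hP : 0 < S.rates.equiP) (hQ : 0 < S.rates.equiQ)
    {c : ℝ} (hc : 0 < c) (hD : IsDiffusionTensor (volume.restrict S.T.domain) S.D c)
    (htrD : ∀ (F : S.T.InnerFacet) (K : S.T.Elem), F.1 ⊆ K.1 →
      IsDiffusionTensor F.surface (S.trD K) c)
    (heps : 0 < S.eps) (heta0 : 0 ≤ S.eta0) (hpos : ∀ v, v ≠ 0 → 0 < S.ldg v v) {k : ℝ}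
    (hk : 0 < k) (b : Species → ιW → ℝ) :
    ∃ R₀, 0 ≤ R₀ ∧ ∀ (θ : ℝ) (wp wq : ιW → ℝ), 0 ≤ θ → θ ≤ 1 →
      S.reducedOp k .p wp = θ • (S.vecF .p wp wq + b .p) →
      S.reducedOp k .q wq = θ • (S.vecF .q wp wq + b .q) → ‖wp‖ + ‖wq‖ ≤ R₀ := by
  obtain ⟨α, C₀, hα, hC₀, hcoer⟩ :=
    exists_mul_sq_norm_sub_le_reducedOp hP hQ hc hD htrD heps heta0 hpos hk.le
  obtain ⟨C₁, hC₁, hmass⟩ := exists_integral_u_q_le hlP.le hlQ hkap.le hP hQ hc htrD hk b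
  obtain ⟨C₂, hC₂, habs⟩ := exists_abs_evalW_le S
  have hV := integral_one_nonneg (S := S)
  set V : ℝ := Mesh.integral fun (_ : S.T.Elem) _ => (1 : ℝ) with hVdef
  set m : ℝ := S.rates.mu * S.rates.equiP with hm
  have hm0 : 0 ≤ m := by positivity
  -- `δ` is so small that the superlinear term is absorbed by half of the coercivity
  set δ : ℝ := α / 8 / (m * C₁ + 1) with hδ
  have hδ0 : 0 < δ := by positivity
  obtain ⟨C₃, hC₃, hsub⟩ := exists_max_evalW_le_of_integral_u_q_le (S := S) hQ hC₁ hδ0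
  set β : ℝ := (∑ i, |b .p i|) + ∑ i, |b .q i| with hβ
  have hβ0 : 0 ≤ β := by positivity
  refine ⟨max 1 (8 * (S.rates.kappa * C₂ * V + β + (S.rates.lamQ * S.rates.equiQ * V + 2 * C₀)
    + m * ((1 + C₃) * C₁)) / α), le_max_of_le_left zero_le_one, ?_⟩
  intro θ wp wq hθ0 hθ1 hp hq
  set R := ‖wp‖ + ‖wq‖ with hR
  have hR0 : 0 ≤ R := by positivity
  have hmassR := hmass θ wp wq hθ0 hθ1 hp hq
  have hmaxR := hsub wq R (by linarith [norm_nonneg wp]) hmassR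
  set Q : ℝ := Mesh.integral fun K x => S.rates.u .q (Mesh.evalW (S.fn wq) K x) with hQdef
  have hreac : wp ⬝ᵥ S.vecF .p wp wq + wq ⬝ᵥ S.vecF .q wp wq
      ≤ (S.rates.kappa * (C₂ * R) + S.rates.lamQ * S.rates.equiQ) * V
        + m * (1 + (δ * R + C₃)) * Q :=
    dotProduct_vecF_add_dotProduct_vecF_le hkap.le hlP hlQ hmu hP hQ wp wq
      (fun K x hx => (habs wp K x hx).trans
        (mul_le_mul_of_nonneg_left (by linarith [norm_nonneg wq]) hC₂)) hmaxR
  have hb : wp ⬝ᵥ b .p + wq ⬝ᵥ b .q ≤ β * R := by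
    have h1 := (le_abs_self _).trans (abs_dotProduct_le_sum_abs_mul_norm (b .p) wp)
    have h2 := (le_abs_self _).trans (abs_dotProduct_le_sum_abs_mul_norm (b .q) wq)
    rw [dotProduct_comm wp, dotProduct_comm wq, hβ, hR]
    have h3 : 0 ≤ (∑ i, |b .p i|) * ‖wq‖ := by positivity
    have h4 : 0 ≤ (∑ i, |b .q i|) * ‖wp‖ := by positivity
    linarith
  have hQ0 : 0 ≤ Q := Finset.sum_nonneg fun K _ => setIntegral_nonneg K.measurableSet_carrier
    fun x _ => (Rates.u_pos hP hQ .q _).le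
  have hcp := hcoer .p wp
  have hcq := hcoer .q wq
  rw [hp, dotProduct_smul, dotProduct_add, smul_eq_mul] at hcp
  rw [hq, dotProduct_smul, dotProduct_add, smul_eq_mul] at hcq
  have hQR : m * (1 + (δ * R + C₃)) * Q ≤ m * (1 + (δ * R + C₃)) * (C₁ * (1 + R)) :=
    mul_le_mul_of_nonneg_left hmassR (by positivity)
  have hrhs : θ * (wp ⬝ᵥ S.vecF .p wp wq + wp ⬝ᵥ b .p) + θ * (wq ⬝ᵥ S.vecF .q wp wq + wq ⬝ᵥ b .q)
      ≤ (S.rates.kappa * (C₂ * R) + S.rates.lamQ * S.rates.equiQ) * V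
        + m * (1 + (δ * R + C₃)) * (C₁ * (1 + R)) + β * R := by
    have h0 : 0 ≤ (S.rates.kappa * (C₂ * R) + S.rates.lamQ * S.rates.equiQ) * V
        + m * (1 + (δ * R + C₃)) * (C₁ * (1 + R)) + β * R := by positivity
    refine le_trans (le_of_eq_of_le ?_ (mul_le_mul_of_nonneg_left
      (add_le_add (hreac.trans (add_le_add_right hQR _)) hb) hθ0)) (mul_le_of_le_one_left h0 hθ1)
    ring
  have hδm : m * C₁ * δ ≤ α / 8 := by
    rw [hδ, mul_div_assoc', div_le_iff₀ (by positivity)]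
    nlinarith
  have hsq : α / 2 * R ^ 2 ≤ α * ‖wp‖ ^ 2 + α * ‖wq‖ ^ 2 := by
    have h := mul_nonneg hα.le (sq_nonneg (‖wp‖ - ‖wq‖))
    have h' : α * ‖wp‖ ^ 2 + α * ‖wq‖ ^ 2 = α / 2 * R ^ 2 + α * (‖wp‖ - ‖wq‖) ^ 2 / 2 := by
      rw [hR]; ring
    linarith
  refine le_max_of_quadratic_le hα (by positivity) hm0 hC₁ hC₃ (by positivity) hδm ?_
  linarith

/-- One time step is solvable, for any data `b` from the previous step. The zero of the vector field
is found for the system with right-hand side cut off outside of the a priori bound, which holds for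
the cut-off system as well. -/
theorem exists_reducedOp_eq (hkap : 0 < S.rates.kappa) (hlP : 0 < S.rates.lamP)
    (hlQ : 0 ≤ S.rates.lamQ) (hmu : 0 ≤ S.rates.mu)
    (hP : 0 < S.rates.equiP) (hQ : 0 < S.rates.equiQ)
    {c : ℝ} (hc : 0 < c) (hD : IsDiffusionTensor (volume.restrict S.T.domain) S.D c)
    (htrD : ∀ (F : S.T.InnerFacet) (K : S.T.Elem), F.1 ⊆ K.1 →
      IsDiffusionTensor F.surface (S.trD K) c)
    (heps : 0 < S.eps) (heta0 : 0 ≤ S.eta0) (hpos : ∀ v, v ≠ 0 → 0 < S.ldg v v) {k : ℝ}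
    (hk : 0 < k) (b : Species → ιW → ℝ) :
    ∃ w : Species → ιW → ℝ, ∀ a, S.reducedOp k a (w a) = S.vecF a (w .p) (w .q) + b a := by
  obtain ⟨R₀, hR₀, hbound⟩ := exists_norm_add_norm_le hkap hlP hlQ hmu hP hQ hc hD htrD heps heta0
    hpos hk b
  obtain ⟨α, C, hα, hC, hcoer⟩ :=
    exists_mul_sq_norm_sub_le_reducedOp hP hQ hc hD htrD heps heta0 hpos hk.le
  let θ : (ιW ⊕ ιW → ℝ) → ℝ := fun x =>
    max 0 (min 1 (R₀ + 1 - (‖x ∘ Sum.inl‖ + ‖x ∘ Sum.inr‖)))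
  let res : Species → (ιW ⊕ ιW → ℝ) → (ιW → ℝ) → ιW → ℝ := fun a x w =>
    S.reducedOp k a w - θ x • (S.vecF a (x ∘ Sum.inl) (x ∘ Sum.inr) + b a)
  let g : (ιW ⊕ ιW → ℝ) → ιW ⊕ ιW → ℝ := fun x =>
    Sum.elim (res .p x (x ∘ Sum.inl)) (res .q x (x ∘ Sum.inr))
  have hl : Continuous fun x : ιW ⊕ ιW → ℝ => x ∘ Sum.inl :=
    continuous_pi fun i => continuous_apply _
  have hr : Continuous fun x : ιW ⊕ ιW → ℝ => x ∘ Sum.inr :=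
    continuous_pi fun i => continuous_apply _
  have hθ : Continuous θ :=
    continuous_const.max (continuous_const.min (continuous_const.sub (hl.norm.add hr.norm)))
  have hres : ∀ a {y : (ιW ⊕ ιW → ℝ) → ιW → ℝ}, Continuous y →
      Continuous fun x => res a x (y x) := fun a y hy =>
    ((continuous_reducedOp hP hQ hc hD k a).comp hy).sub
      (hθ.smul (((continuous_vecF a).comp (hl.prodMk hr)).add continuous_const))
  have hg : Continuous g := by
    refine continuous_pi fun i => ?_
    rcases i with i | i
    · exact (continuous_apply i).comp (hres .p hl)
    · exact (continuous_apply i).comp (hres .q hr)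
  set N : ℝ := (Fintype.card ιW : ℝ) with hN
  have hN0 : 0 ≤ N := Nat.cast_nonneg _
  -- on the sphere of squared radius `(N + 1) M`, the right-hand side is cut off completely and the
  -- coercivity outweighs the constant `C`
  set M : ℝ := (R₀ + 1) ^ 2 + 2 * C / α + 1 with hM
  have hM0 : 0 < M := by positivity
  obtain ⟨x, hx⟩ := exists_eq_zero_of_continuous_of_dotProduct_pos hg
    (R := Real.sqrt ((N + 1) * M)) (by positivity) (fun x hxR => by
      rw [Real.sq_sqrt (by positivity)] at hxR
      have hx : x = Sum.elim (x ∘ Sum.inl) (x ∘ Sum.inr) := (Sum.elim_comp_inl_inr x).symm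
      rw [hx, sumElim_dotProduct_sumElim] at hxR
      have h1 := dotProduct_self_le_card_mul_sq_norm (x ∘ Sum.inl)
      have h2 := dotProduct_self_le_card_mul_sq_norm (x ∘ Sum.inr)
      have h3 : M ≤ ‖x ∘ Sum.inl‖ ^ 2 + ‖x ∘ Sum.inr‖ ^ 2 := by
        have h4 : (N + 1) * M ≤ (N + 1) * (‖x ∘ Sum.inl‖ ^ 2 + ‖x ∘ Sum.inr‖ ^ 2) := by
          nlinarith [sq_nonneg ‖x ∘ Sum.inl‖, sq_nonneg ‖x ∘ Sum.inr‖]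
        exact le_of_mul_le_mul_left h4 (by positivity)
      have h5 : R₀ + 1 ≤ ‖x ∘ Sum.inl‖ + ‖x ∘ Sum.inr‖ := by
        refine le_of_sq_le_sq ?_ (by positivity)
        have : 0 ≤ 2 * C / α := by positivity
        nlinarith [mul_nonneg (norm_nonneg (x ∘ Sum.inl)) (norm_nonneg (x ∘ Sum.inr))]
      have hθ0 : θ x = 0 := max_eq_left ((min_le_right _ _).trans (by linarith))
      have h6 := hcoer .p (x ∘ Sum.inl)
      have h7 := hcoer .q (x ∘ Sum.inr)
      have h8 : 2 * C < α * M := by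
        have : α * (2 * C / α) = 2 * C := by field_simp
        nlinarith [sq_nonneg (R₀ + 1)]
      have hgx : g x =
          Sum.elim (S.reducedOp k .p (x ∘ Sum.inl)) (S.reducedOp k .q (x ∘ Sum.inr)) := by
        simp only [g, res, hθ0, zero_smul, sub_zero]
      have hdot : g x ⬝ᵥ x = (x ∘ Sum.inl) ⬝ᵥ S.reducedOp k .p (x ∘ Sum.inl)
          + (x ∘ Sum.inr) ⬝ᵥ S.reducedOp k .q (x ∘ Sum.inr) := by
        rw [← sumElim_dotProduct_sumElim, ← hx, ← hgx, dotProduct_comm]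
      rw [hdot]
      nlinarith)
  have hp : res .p x (x ∘ Sum.inl) = 0 := funext fun i => congrFun hx (Sum.inl i)
  have hq : res .q x (x ∘ Sum.inr) = 0 := funext fun i => congrFun hx (Sum.inr i)
  have hle := hbound (θ x) (x ∘ Sum.inl) (x ∘ Sum.inr) (le_max_left _ _)
    (max_le zero_le_one (min_le_left _ _)) (sub_eq_zero.1 hp) (sub_eq_zero.1 hq)
  have hθ1 : θ x = 1 := by
    have : min 1 (R₀ + 1 - (‖x ∘ Sum.inl‖ + ‖x ∘ Sum.inr‖)) = 1 := min_eq_left (by linarith)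
    simp only [θ, this]
    exact max_eq_right zero_le_one
  refine ⟨fun a => match a with | .p => x ∘ Sum.inl | .q => x ∘ Sum.inr, fun a => ?_⟩
  cases a
  · have := sub_eq_zero.1 hp
    rwa [hθ1, one_smul] at this
  · have := sub_eq_zero.1 hq
    rwa [hθ1, one_smul] at this

/-- A solution of the reduced system, together with the vectors `Σ_⋆` from the first equation,
solves the system of the time step. -/
theorem exists_isStep [DecidableEq ιW] (hkap : 0 < S.rates.kappa) (hlP : 0 < S.rates.lamP)
    (hlQ : 0 < S.rates.lamQ) (hmu : 0 < S.rates.mu) (hups : 0 < S.rates.upsilon)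
    {c : ℝ} (hc : 0 < c) (hD : IsDiffusionTensor (volume.restrict S.T.domain) S.D c)
    (htrD : ∀ (F : S.T.InnerFacet) (K : S.T.Elem), F.1 ⊆ K.1 →
      IsDiffusionTensor F.surface (S.trD K) c)
    (heps : 0 < S.eps) (heta0 : 0 ≤ S.eta0) (hpos : ∀ v, v ≠ 0 → 0 < S.ldg v v) {n : ℕ}
    (hn : S.t n < S.t (n + 1)) (prev : Species → ιW → ℝ) : ∃ w s, S.IsStep n prev w s := by
  have hP : 0 < S.rates.equiP := div_pos hkap hlP
  have hQ : 0 < S.rates.equiQ := div_pos hups (mul_pos hlQ hmu)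
  have htau : 0 < 1 / S.tau n := one_div_pos.2 (sub_pos.2 hn)
  obtain ⟨w, hw⟩ := exists_reducedOp_eq hkap hlP hlQ.le hmu.le hP hQ hc hD htrD heps heta0 hpos
    htau fun a => (1 / S.tau n) • S.vecPrev n prev a
  refine ⟨w, fun a => S.sigma a (w a), fun a => ⟨matN_mulVec_sigma hP hQ hc hD a (w a), ?_⟩⟩
  rw [sub_eq_add_neg]
  exact hw a

end Scheme

end ConformationalLDG

theorem mainTheorem4 {d l : ℕ} (hd : d = 2 ∨ d = 3) (hl : 1 ≤ l)
    {ιW ιR : Type*} [Fintype ιW] [DecidableEq ιW] [Fintype ιR] [DecidableEq ιR]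
    (S : ConformationalLDG.Scheme d l ιW ιR)
    -- positive rates, with positive equilibrium of `q`
    (hkappa : 0 < S.rates.kappa) (hlamP : 0 < S.rates.lamP) (hlamQ : 0 < S.rates.lamQ)
    (hmu : 0 < S.rates.mu) (hupsilon : 0 < S.rates.upsilon)
    -- the diffusion tensor in `Ω`, and its one-sided values on the internal facets
    (dupd : ℝ) (hdupd : 0 < dupd)
    (hD : ConformationalLDG.IsDiffusionTensor (MeasureTheory.volume.restrict S.T.domain) S.D dupd)
    (htrD : ∀ (F : S.T.InnerFacet) (K : S.T.Elem), F.1 ⊆ K.1 →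
      ConformationalLDG.IsDiffusionTensor F.surface (S.trD K) dupd)
    -- the initial data
    (hp0 : MeasureTheory.AEStronglyMeasurable (S.initial .p)
      (MeasureTheory.volume.restrict S.T.domain))
    (hp0_bd : ∀ᵐ x ∂(MeasureTheory.volume.restrict S.T.domain),
      0 ≤ S.initial .p x ∧ S.initial .p x ≤ S.rates.equiP)
    (hq0 : MeasureTheory.MemLp (S.initial .q) ⊤ (MeasureTheory.volume.restrict S.T.domain))
    (hq0_nonneg : ∀ᵐ x ∂(MeasureTheory.volume.restrict S.T.domain), 0 ≤ S.initial .q x)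
    -- the time partition
    (ht0 : S.t 0 = 0) (ht : ∀ n < S.steps, S.t n < S.t (n + 1))
    -- the parameters of the method
    (heps : 0 < S.eps) (heta0 : 0 < S.eta0)
    (hgamma : ∀ F, S.gamma F ∈ Set.Icc (0 : ℝ) 1)
    -- `(·,·)_LDG` is an inner product
    (hldg_symm : ∀ v w, S.ldg v w = S.ldg w v) (hldg_pos : ∀ v, v ≠ 0 → 0 < S.ldg v v) :
    -- at each time step, for any solutions at the previous steps, the system is solvable
    (∀ n < S.steps, ∀ (w : ℕ → ConformationalLDG.Species → ιW → ℝ)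
        (s : ℕ → ConformationalLDG.Species → ιR → ℝ),
      (∀ k < n, S.IsStep k (w k) (w (k + 1)) (s (k + 1))) →
      ∃ (w' : ConformationalLDG.Species → ιW → ℝ) (s' : ConformationalLDG.Species → ιR → ℝ),
        S.IsStep n (w n) w' s') ∧
    -- in particular, there is a solution over all time steps
    (∃ (w : ℕ → ConformationalLDG.Species → ιW → ℝ)
        (s : ℕ → ConformationalLDG.Species → ιR → ℝ),
      ∀ n < S.steps, S.IsStep n (w n) (w (n + 1)) (s (n + 1))) := by
  have step : ∀ n < S.steps, ∀ prev : ConformationalLDG.Species → ιW → ℝ,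
      ∃ (w : ConformationalLDG.Species → ιW → ℝ) (s : ConformationalLDG.Species → ιR → ℝ),
        S.IsStep n prev w s := fun n hn prev =>
    ConformationalLDG.Scheme.exists_isStep hkappa hlamP hlamQ hmu hupsilon hdupd hD htrD heps
      heta0.le hldg_pos (ht n hn) prev
  refine ⟨fun n hn w _ _ => step n hn (w n), ?_⟩
  have step' : ∀ (n : ℕ) (prev : ConformationalLDG.Species → ιW → ℝ),
      ∃ z : (ConformationalLDG.Species → ιW → ℝ) × (ConformationalLDG.Species → ιR → ℝ),
        n < S.steps → S.IsStep n prev z.1 z.2 := by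
    intro n prev
    by_cases hn : n < S.steps
    · obtain ⟨w, s, h⟩ := step n hn prev
      exact ⟨(w, s), fun _ => h⟩
    · exact ⟨(0, 0), fun h => absurd h hn⟩
  choose next hnext using step'
  -- the vectors `w 0` are arbitrary, since the first step starts from the initial data
  let w : ℕ → ConformationalLDG.Species → ιW → ℝ := fun n =>
    Nat.rec 0 (fun k prev => (next k prev).1) n
  exact ⟨w, fun n => (next (n - 1) (w (n - 1))).2, fun n hn => hnext n (w n) hn⟩
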